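/- **Setting.** Let $S$ be a set of process terms and $AP$ a set of atomic propositions. Let $\mathsf{next}$ assign to each $s\in S$ a finite list of pairs $(s',p')$ with $s'\in S$, $0<p'\le 1$ and $\sum_{(s',p')\in\mathsf{next}(s)}p'=1$, and let $\mathsf{lab\_eval}(s,a)\in\{\mathsf{true},\mathsf{false}\}$ for $s\in S$, $a\in AP$. They define a labelled discrete time Markov chain $\mathcal M$ with state set $S$: the one-step probability $\mathbf P_{s,t}$ is the sum of the $p'$ over the entries $(t,p')$ of $\mathsf{next}(s)$, and $a$ holds in $s$ iff $\mathsf{lab\_eval}(s,a)=\mathsf{true}$. PCTL state formulas are $\Phi::=a\mid\neg\Phi\mid\Phi\vee\Phi\mid\mathcal P_{\bowtie p}[\varphi]$ with path formulas $\varphi::=\mathcal X\,\Phi\mid\Phi\,\mathcal U^{\le k}\,\Phi\mid\Phi\,\mathcal U\,\Phi$, where $\bowtie\,\in\{\le,<,>,\ge\}$, $p\in[0,1]$, $k\in\mathbb N$. Satisfaction is the standard one: $s\models_{\mathcal M}\mathcal P_{\bowtie p}[\varphi]$ iff $\Pr_s(\varphi)\bowtie p$, where $\Pr_s(\varphi)$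 is the probability of the infinite paths of $\mathcal M$ from $s$ that satisfy $\varphi$. **Algorithm.** Let $\varepsilon>0$. The on-the-fly procedure $\mathsf{Check}(s,\Phi)$ (with real arithmetic) works recursively on $\Phi$. It evaluates atoms by $\mathsf{lab\_eval}$, it evaluates $\neg$ and $\vee$ as Boolean operations, and for $\mathcal P_{\bowtie p}[\varphi]$ it compares a computed number $\mathsf{CheckPath}(s,\varphi)$ with $p$: * For $\mathcal X\,\Phi$ the number is the sum of the $p'$ over the $(s',p')\in\mathsf{next}(s)$ with $\mathsf{Check}(s',\Phi)=\mathsf{true}$. * For the until operators, a state $t$ is labelled YES if $\mathsf{Check}(t,\Phi_2)=\mathsf{true}$, otherwise NO if $\mathsf{Check}(t,\Phi_1)=\mathsf{false}$, otherwise UNKNOWN. If $s$ is YES or NO, the number is $1$ or $0$. Otherwise the states reachable from $s$ through UNKNOWN states are generated breadth first (for $\mathcal U^{\le k}$: for at most $k$ rounds), recording for each generated state the list of its predecessors with their probabilities. If no YES state is found, the number is $0$. * For $\Phi_1\,\mathcal U^{\le k}\,\Phi_2$, $k$ backward iterations over the predecessor lists, starting from the YES states, then compute the number. * For $\Phi_1\,\mathcal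 U\,\Phi_2$, all generated states that cannot reach a YES state are relabelled NO; if there is no NO state, the number is $1$. Otherwise all generated states that cannot reach a NO state are relabelled YES. Then, for $i=0,1,2,\dots$, backward iterations compute for each generated state $r$ the probabilities $p_{yes}(r)$, $p_{no}(r)$ of reaching within $i$ steps, through UNKNOWN states, a YES or a NO state respectively (these states being absorbing), until $p_{yes}(r)+p_{no}(r)\ge 1-\varepsilon$ for all generated $r$; the number is $p_{yes}(s)$. **Theorem.** For all such $\mathsf{next}$, $\mathsf{lab\_eval}$ and $\varepsilon>0$: 1. If $\Phi$ contains no unbounded until, or the set of states reachable from $s$ is finite, then $\mathsf{Check}(s,\Phi)$ terminates. 2. Suppose that $\mathsf{Check}(s,\Phi)$ terminates and that for every occurrence of $\mathcal P_{\bowtie p}[\Phi_1\,\mathcal U\,\Phi_2]$ in $\Phi$ (at any depth) and every state $t$ reachable from $s$, the number $\Pr_t(\Phi_1\,\mathcal U\,\Phi_2)$ is $0$, or is $1$, or differs from $p$ by more than $\varepsilon$. Then $s\models_{\mathcal M}\Phi$ if and only if $\mathsf{Check}(s,\Phi)=\mathsf{true}$. In particular this equivalence holds for all $s$ and all $\Phi$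 without unbounded until. 3. For all formulas the equivalence holds up to the tolerance $\varepsilon$: there is a relation $\models^{\varepsilon}$ between states and state formulas such that, whenever $\mathsf{Check}(s,\Phi)$ terminates, $s\models^{\varepsilon}\Phi$ if and only if $\mathsf{Check}(s,\Phi)=\mathsf{true}$, and which obeys all clauses of the PCTL satisfaction relation (with $\models^\varepsilon$ for the subformulas) except the one for unbounded until, which is replaced by: for all $s,\Phi_1,\Phi_2$ there is $q\in[0,1]$ with $|q-x|\le\varepsilon$, where $x$ is the probability of the paths $\sigma$ from $s$ such that for some $k$, $\sigma[k]\models^{\varepsilon}\Phi_2$ and $\sigma[i]\models^{\varepsilon}\Phi_1$ for all $i<k$, with $q=x$ if $x\in\{0,1\}$, and such that for all $\bowtie$ and $p$: $s\models^{\varepsilon}\mathcal P_{\bowtie p}[\Phi_1\,\mathcal U\,\Phi_2]$ iff $q\bowtie p$. -/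

import Mathlib

noncomputable section

namespace PCTL

open MeasureTheory ProbabilityTheory
open scoped Classical

universe u v

/-! ## Syntax of PCTL -/

/-- The comparison operators `≤`, `<`, `>`, `≥`. -/
inductive Cmp : Type
  | le | lt | gt | ge

/-- `c.holds x y` is the relation `x ⋈ y`. -/
def Cmp.holds : Cmp → ℝ → ℝ → Prop
  | .le, x, y => x ≤ y
  | .lt, x, y => x < y
  | .gt, x, y => x > y
  | .ge, x, y => x ≥ y

mutual
/-- State formulas `Φ ::= a | ¬ Φ | Φ ∨ Φ | P_{⋈ p}[φ]` over the atomic propositions `AP`. -/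
inductive StateFormula (AP : Type v) : Type v
  | atom (a : AP) : StateFormula AP
  | neg (Φ : StateFormula AP) : StateFormula AP
  | or (Φ₁ Φ₂ : StateFormula AP) : StateFormula AP
  | prob (c : Cmp) (p : unitInterval) (φ : PathFormula AP) : StateFormula AP
/-- Path formulas `φ ::= X Φ | Φ U^{≤ k} Φ | Φ U Φ`. -/
inductive PathFormula (AP : Type v) : Type v
  | next (Φ : StateFormula AP) : PathFormula AP
  | boundedUntil (Φ₁ : StateFormula AP) (k : ℕ) (Φ₂ : StateFormula AP) : PathFormula AP
  | unboundedUntil (Φ₁ Φ₂ : StateFormula AP) : PathFormula AP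
end

/-- An occurrence of `P_{⋈ p}[Φ₁ U Φ₂]` in a formula, recorded as the threshold `p` together with
the operands `Φ₁` and `Φ₂`. -/
structure UntilOccurrence (AP : Type v) : Type v where
  threshold : unitInterval
  left : StateFormula AP
  right : StateFormula AP

mutual
/-- The occurrences (at any depth) of `P_{⋈ p}[Φ₁ U Φ₂]` in a state formula. -/
def StateFormula.untils {AP : Type v} : StateFormula AP → Set (UntilOccurrence AP)
  | .atom _ => ∅
  | .neg Φ => Φ.untils
  | .or Φ₁ Φ₂ => Φ₁.untils ∪ Φ₂.untils
  | .prob _ p φ => φ.untils p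
/-- The same for a path formula standing under an operator `P_{⋈ p}`. -/
def PathFormula.untils {AP : Type v} : PathFormula AP → unitInterval → Set (UntilOccurrence AP)
  | .next Φ, _ => Φ.untils
  | .boundedUntil Φ₁ _ Φ₂, _ => Φ₁.untils ∪ Φ₂.untils
  | .unboundedUntil Φ₁ Φ₂, p => insert ⟨p, Φ₁, Φ₂⟩ (Φ₁.untils ∪ Φ₂.untils)
end

/-! ## The abstract interpreter and its labelled DTMC -/

/-- An abstract interpreter for a language with process terms `S` and atomic propositions `AP`:
the functions `next` and `lab_eval`. -/
structure Interpreter (S : Type u) (AP : Type v) where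
  next : S → List (S × ℝ)
  labEval : S → AP → Bool
  next_pos : ∀ s, ∀ x ∈ next s, 0 < x.2
  next_le_one : ∀ s, ∀ x ∈ next s, x.2 ≤ 1
  next_sum : ∀ s, ((next s).map Prod.snd).sum = 1

variable {S : Type u} {AP : Type v}

/-- One-step probability matrix of the DTMC: a term may be listed several times by `next`. -/
def Interpreter.trans (I : Interpreter S AP) (s t : S) : ℝ :=
  (((I.next s).filter (fun x => x.1 = t)).map Prod.snd).sum

/-- `t` is reachable from `s` in finitely many (possibly zero) steps of positive probability. -/
def Interpreter.Reachable (I : Interpreter S AP) (s t : S) : Prop :=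
  Relation.ReflTransGen (fun a b => 0 < I.trans a b) s t

/-- The finitely supported measure with the weights of a list of pairs. -/
def listMeasure [MeasurableSpace S] : List (S × ℝ) → Measure S
  | [] => 0
  | x :: l => ENNReal.ofReal x.2 • Measure.dirac x.1 + listMeasure l

theorem listMeasure_univ [MeasurableSpace S] (l : List (S × ℝ)) (h : ∀ x ∈ l, 0 < x.2) :
    listMeasure l Set.univ = ENNReal.ofReal (l.map Prod.snd).sum := by
  induction l with
  | nil => simp [listMeasure]
  | cons x l ih =>
    have h1 : 0 ≤ (l.map Prod.snd).sum :=
      List.sum_nonneg (by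
        intro y hy
        obtain ⟨z, hz, rfl⟩ := List.mem_map.1 hy
        exact (h z (by simp [hz])).le)
    rw [List.map_cons, List.sum_cons, ENNReal.ofReal_add (h x (by simp)).le h1,
      ← ih fun y hy => h y (by simp [hy])]
    simp [listMeasure]

/-- The one-step distribution from `s`, on `S` with the discrete `σ`-algebra. -/
def Interpreter.stepKernel (I : Interpreter S AP) : @Kernel S S ⊤ ⊤ :=
  letI : MeasurableSpace S := ⊤
  ⟨fun s => listMeasure (I.next s), measurable_from_top⟩

instance Interpreter.isMarkovKernel_stepKernel (I : Interpreter S AP) :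
    @IsMarkovKernel S S ⊤ ⊤ I.stepKernel := by
  let : MeasurableSpace S := ⊤
  refine ⟨fun s => ⟨?_⟩⟩
  change listMeasure (I.next s) Set.univ = 1
  rw [listMeasure_univ _ (I.next_pos s), I.next_sum, ENNReal.ofReal_one]

/-- The law on `ℕ → S` (product of the discrete `σ`-algebras) of the DTMC started in `s`. -/
def Interpreter.pathMeasure (I : Interpreter S AP) (s : S) :
    @Measure (ℕ → S) (@MeasurableSpace.pi ℕ (fun _ => S) fun _ => ⊤) :=
  letI : MeasurableSpace S := ⊤
  haveI := I.isMarkovKernel_stepKernel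
  Kernel.traj (X := fun _ : ℕ => S)
    (fun n => I.stepKernel.comap
      (fun h : (i : Finset.Iic n) → S => h ⟨n, Finset.mem_Iic.2 le_rfl⟩)
      (measurable_pi_apply _)) 0 (fun _ => s)

/-- The infinite paths from `s`. -/
def Interpreter.paths (I : Interpreter S AP) (s : S) : Set (ℕ → S) :=
  {σ | σ 0 = s ∧ ∀ i, 0 < I.trans (σ i) (σ (i + 1))}

/-- `Pr {σ ∈ Paths(s) | E σ}`. -/
def Interpreter.pr (I : Interpreter S AP) (s : S) (E : (ℕ → S) → Prop) : ℝ :=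
  (I.pathMeasure s {σ | σ ∈ I.paths s ∧ E σ}).toReal

/-! ## Semantics of PCTL -/

/-- `B₁ U^{≤ k} B₂` along `σ`. -/
def BoundedUntilAlong (B₁ : S → Prop) (k : ℕ) (B₂ : S → Prop) (σ : ℕ → S) : Prop :=
  ∃ h ≤ k, B₂ (σ h) ∧ ∀ i < h, B₁ (σ i)

/-- `B₁ U B₂` along `σ`. -/
def UntilAlong (B₁ B₂ : S → Prop) (σ : ℕ → S) : Prop :=
  ∃ k, B₂ (σ k) ∧ ∀ i < k, B₁ (σ i)

mutual
/-- The satisfaction relation `s ⊨ Φ`. -/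
def Interpreter.Sat (I : Interpreter S AP) : StateFormula AP → S → Prop
  | .atom a, s => I.labEval s a = true
  | .neg Φ, s => ¬ I.Sat Φ s
  | .or Φ₁ Φ₂, s => I.Sat Φ₁ s ∨ I.Sat Φ₂ s
  | .prob c p φ, s => c.holds (I.pr s (I.PathSat φ)) p
/-- The satisfaction relation `σ ⊨ φ`. -/
def Interpreter.PathSat (I : Interpreter S AP) : PathFormula AP → (ℕ → S) → Prop
  | .next Φ, σ => I.Sat Φ (σ 1)
  | .boundedUntil Φ₁ k Φ₂, σ => BoundedUntilAlong (I.Sat Φ₁) k (I.Sat Φ₂) σ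
  | .unboundedUntil Φ₁ Φ₂, σ => UntilAlong (I.Sat Φ₁) (I.Sat Φ₂) σ
end

/-- `q` is a probability within `ε` of the probability `x`, and equal to `x` if `x` is `0` or `1`. -/
structure Approx (ε q x : ℝ) : Prop where
  nonneg : 0 ≤ q
  le_one : q ≤ 1
  abs_le : |q - x| ≤ ε
  eq_zero : x = 0 → q = 0
  eq_one : x = 1 → q = 1

/-- `R` obeys all clauses of the satisfaction relation of PCTL, except that the probability of
an unbounded until is replaced, in each state, by an approximation of it with tolerance `ε`. -/
structure Interpreter.IsApproxSat (I : Interpreter S AP) (ε : ℝ)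
    (R : StateFormula AP → S → Prop) : Prop where
  atom : ∀ a s, R (.atom a) s ↔ I.labEval s a = true
  neg : ∀ Φ s, R (.neg Φ) s ↔ ¬ R Φ s
  or : ∀ Φ₁ Φ₂ s, R (.or Φ₁ Φ₂) s ↔ R Φ₁ s ∨ R Φ₂ s
  next : ∀ c p Φ s, R (.prob c p (.next Φ)) s ↔ c.holds (I.pr s fun σ => R Φ (σ 1)) p
  boundedUntil : ∀ c p Φ₁ k Φ₂ s, R (.prob c p (.boundedUntil Φ₁ k Φ₂)) s ↔
    c.holds (I.pr s (BoundedUntilAlong (R Φ₁) k (R Φ₂))) p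
  unboundedUntil : ∀ Φ₁ Φ₂ s, ∃ q, Approx ε q (I.pr s (UntilAlong (R Φ₁) (R Φ₂))) ∧
    ∀ c p, R (.prob c p (.unboundedUntil Φ₁ Φ₂)) s ↔ c.holds q p

/-- In every state reachable from `s`, the probability of each unbounded until occurring in `Φ`
is `0`, or `1`, or differs from the threshold by more than `ε`. -/
def Interpreter.ThresholdsClear (I : Interpreter S AP) (ε : ℝ) (Φ : StateFormula AP) (s : S) :
    Prop :=
  ∀ o ∈ Φ.untils, ∀ t, I.Reachable s t →
    I.pr t (I.PathSat (.unboundedUntil o.left o.right)) = 0 ∨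
    I.pr t (I.PathSat (.unboundedUntil o.left o.right)) = 1 ∨
    ε < |I.pr t (I.PathSat (.unboundedUntil o.left o.right)) - o.threshold|

/-! ## The model checking algorithm

Programs that may fail to terminate take values in `Part`. Floats are modelled by reals. -/

/-- `while cond x do x := body x`; undefined if the loop does not terminate. -/
def whileLoop {X : Type*} (cond : X → Prop) (body : X → Part X) : X → Part X :=
  PFun.fix fun x => if cond x then (body x).map Sum.inr else Part.some (Sum.inl x)

/-- Hash maps: a finite set of keys and a value for each key (`val` is only used on keys). -/
structure Table (S : Type u) (R : Type v) where
  keys : Finset S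
  val : S → R

/-- `{s ↦ r}` -/
def Table.single {R : Type v} (s : S) (r : R) : Table S R := ⟨{s}, fun _ => r⟩

/-- `M[s ↦ r]` -/
def Table.insert {R : Type v} (M : Table S R) (s : S) (r : R) : Table S R :=
  ⟨Insert.insert s M.keys, Function.update M.val s r⟩

/-- Change the record of `s`. -/
def Table.modify {R : Type v} (M : Table S R) (s : S) (f : R → R) : Table S R :=
  ⟨M.keys, Function.update M.val s (f (M.val s))⟩

/-- Change the records of all elements of `A`. -/
def Table.modifyAll {R : Type v} (M : Table S R) (A : Finset S) (f : R → R) : Table S R :=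
  ⟨M.keys, fun s => if s ∈ A then f (M.val s) else M.val s⟩

inductive Label : Type
  | yes | no | unknown

/-- The records stored by the algorithm. A record is identified by its term, which is its key in
the hash map. `prec` lists predecessors with transition probabilities, `data` holds the arrays of
probabilities. -/
structure Record (S : Type u) (D : Type) where
  prec : List (S × ℝ)
  label : Label
  data : D

/-- The array `p` of a record for bounded until; only the entries `0, …, k` are used. -/
abbrev BUData : Type := ℕ → ℝ

/-- The arrays `p_yes` and `p_no` of a record for unbounded until. -/
structure UUData : Type where
  pYes : Fin 2 → ℝ
  pNo : Fin 2 → ℝ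

/-- `Check(s, Φ₂)` and, if it fails, `Check(s, Φ₁)` determine the label of `s`. -/
def computeLabel (check₁ check₂ : S → Part Bool) (s : S) : Part Label :=
  (check₂ s).bind fun b₂ =>
    if b₂ then Part.some .yes
    else (check₁ s).map fun b₁ => if b₁ then .unknown else .no

/-- `createBUStructure` -/
def createBU (check₁ check₂ : S → Part Bool) (k : ℕ) (s : S) : Part (Record S BUData) :=
  (computeLabel check₁ check₂ s).map fun l =>
    match l with
    | .yes => ⟨[], .yes, fun i => if i ≤ k then 1 else 0⟩
    | .no => ⟨[], .no, fun _ => 0⟩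
    | .unknown => ⟨[], .unknown, fun _ => 0⟩

/-- `createUStructure` -/
def createUU (check₁ check₂ : S → Part Bool) (s : S) : Part (Record S UUData) :=
  (computeLabel check₁ check₂ s).map fun l =>
    match l with
    | .yes => ⟨[], .yes, ⟨fun _ => 1, fun _ => 0⟩⟩
    | .no => ⟨[], .no, ⟨fun _ => 0, fun _ => 1⟩⟩
    | .unknown => ⟨[], .unknown, ⟨fun _ => 0, fun _ => 0⟩⟩

/-! ### Expansion phase -/

/-- The variables `M`, `S_yes`, `S_no`, `toExpand`. Records are referred to by their terms. -/
structure ExpState (S : Type u) (D : Type) where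
  M : Table S (Record S D)
  yes : Finset S
  no : Finset S
  toExpand : Finset S

/-- The state before the expansion of the `unknown` record `r` of the initial term `s`. -/
def ExpState.init {D : Type} (s : S) (r : Record S D) : ExpState S D :=
  ⟨Table.single s r, ∅, ∅, {s}⟩

/-- The test `r' == ⊥` with its body: enter a record for `t` unless there is one. -/
def discover {D : Type} (create : S → Part (Record S D)) (t : S) (st : ExpState S D) :
    Part (ExpState S D) :=
  if t ∈ st.M.keys then Part.some st
  else (create t).map fun r' =>
    match r'.label with
    | .yes => { st with M := st.M.insert t r', yes := insert t st.yes }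
    | .no => { st with M := st.M.insert t r', no := insert t st.no }
    | .unknown => { st with M := st.M.insert t r', toExpand := insert t st.toExpand }

/-- The body of the loop over `(s', p') ∈ next(r)`; here `x = (s', p')`. -/
def visit {D : Type} (create : S → Part (Record S D)) (r : S) (st : ExpState S D) (x : S × ℝ) :
    Part (ExpState S D) :=
  (discover create x.1 st).map fun st' =>
    { st' with M := st'.M.modify x.1 fun r' => { r' with prec := (r, x.2) :: r'.prec } }

/-- One iteration of the outer loop: expand all terms of `toExpand`. -/
def Interpreter.expandRound {D : Type} (I : Interpreter S AP) (create : S → Part (Record S D))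
    (st : ExpState S D) : Part (ExpState S D) :=
  st.toExpand.toList.foldlM (fun st' r => (I.next r).foldlM (visit create r) st')
    { st with toExpand := ∅ }

/-- The loop with condition `c > 0 ∧ toExpand ≠ ∅`. -/
def Interpreter.expandBounded {D : Type} (I : Interpreter S AP)
    (create : S → Part (Record S D)) : ℕ → ExpState S D → Part (ExpState S D)
  | 0, st => Part.some st
  | c + 1, st =>
    if st.toExpand = ∅ then Part.some st
    else (I.expandRound create st).bind (I.expandBounded create c)

/-- The loop with condition `toExpand ≠ ∅`. -/
def Interpreter.expandUnbounded {D : Type} (I : Interpreter S AP)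
    (create : S → Part (Record S D)) : ExpState S D → Part (ExpState S D) :=
  whileLoop (fun st => st.toExpand ≠ ∅) (I.expandRound create)

/-- Record precedence `r ≺ r'`. -/
def Prec {D : Type} (M : Table S (Record S D)) (r r' : S) : Prop :=
  ∃ p : ℝ, 0 < p ∧ (r, p) ∈ (M.val r').prec

/-- `{r | ∃ r' ∈ A, r ⪯ r'}` -/
def precClosure {D : Type} (M : Table S (Record S D)) (A : Finset S) : Finset S :=
  M.keys.filter fun r => ∃ r' ∈ A, r = r' ∨ Prec M r r'

/-- `{r | ¬ ∃ r' ∈ A, r ⪯* r'}` -/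
def cannotReach {D : Type} (M : Table S (Record S D)) (A : Finset S) : Finset S :=
  M.keys.filter fun r => ¬ ∃ r' ∈ A, Relation.ReflTransGen (Prec M) r r'

/-! ### Bounded until -/

/-- The body of the loop over `r ∈ A` in iteration `i` of the computation phase. -/
def buUpdate (i : ℕ) (M : Table S (Record S BUData)) (r : S) : Table S (Record S BUData) :=
  (M.val r).prec.foldl
    (fun M' x => M'.modify x.1 fun r' =>
      { r' with
        data := Function.update r'.data i (r'.data i + x.2 * (M'.val r).data (i - 1)) }) M

/-- Iteration `i` of the computation phase, on the variables `M` and `A`. -/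
def buIter (st : Table S (Record S BUData) × Finset S) (i : ℕ) :
    Table S (Record S BUData) × Finset S :=
  let M' := st.2.toList.foldl (buUpdate i) st.1
  (M', precClosure M' st.2)

/-- `CheckBoundedUntil`, with `check₁ = Check(·, Φ₁)` and `check₂ = Check(·, Φ₂)`. -/
def Interpreter.checkBoundedUntil (I : Interpreter S AP) (check₁ check₂ : S → Part Bool) (k : ℕ)
    (s : S) : Part ℝ :=
  (createBU check₁ check₂ k s).bind fun r =>
    match r.label with
    | .yes => Part.some 1
    | .no => Part.some 0
    | .unknown =>
      (I.expandBounded (createBU check₁ check₂ k) k (ExpState.init s r)).map fun st =>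
        if st.yes = ∅ then 0
        else (((List.range' 1 k).foldl buIter (st.M, st.yes)).1.val s).data k

/-! ### Unbounded until -/

/-- The index `i mod 2`. -/
def par (i : ℕ) : Fin 2 := Fin.ofNat 2 i

/-- Clear the entry for step `i + 1`. Records labelled `yes` or `no` are absorbing and keep their
probabilities. -/
def uuReset (i : ℕ) (r : Record S UUData) : Record S UUData :=
  match r.label with
  | .unknown => { r with data :=
      ⟨Function.update r.data.pYes (par (i + 1)) 0, Function.update r.data.pNo (par (i + 1)) 0⟩ }
  | _ => r

/-- Add to the entries for step `i + 1` of `r'` the contribution of its successor with data `d`,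
reached with probability `p'`; records labelled `yes` or `no` are absorbing and do not change. -/
def uuAdd (i : ℕ) (p' : ℝ) (d : UUData) (r' : Record S UUData) : Record S UUData :=
  match r'.label with
  | .unknown => { r' with data :=
      ⟨Function.update r'.data.pYes (par (i + 1))
          (r'.data.pYes (par (i + 1)) + p' * d.pYes (par i)),
        Function.update r'.data.pNo (par (i + 1))
          (r'.data.pNo (par (i + 1)) + p' * d.pNo (par i))⟩ }
  | _ => r'

/-- The body of the loop over `r ∈ A` in iteration `i` of the computation phase. -/
def uuUpdate (i : ℕ) (M : Table S (Record S UUData)) (r : S) : Table S (Record S UUData) :=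
  (M.val r).prec.foldl (fun M' x => M'.modify x.1 (uuAdd i x.2 (M'.val r).data)) M

/-- The variables `M`, `A`, `i` of the computation phase. -/
structure UUState (S : Type u) where
  M : Table S (Record S UUData)
  A : Finset S
  i : ℕ

/-- One iteration of the computation phase. -/
def uuIter (st : UUState S) : UUState S :=
  let M' := st.A.toList.foldl (uuUpdate st.i) (st.M.modifyAll st.A (uuReset st.i))
  ⟨M', precClosure M' st.A, st.i + 1⟩

/-- The loop of the computation phase with accuracy `ε`. -/
def uuLoop (ε : ℝ) : UUState S → Part (UUState S) :=
  whileLoop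
    (fun st => ∃ r ∈ st.M.keys,
      (st.M.val r).data.pYes (par st.i) + (st.M.val r).data.pNo (par st.i) < 1 - ε)
    (fun st => Part.some (uuIter st))

/-- What follows the expansion phase started in `s`, given the resulting `M` and `S_yes`. -/
def uuCompute (ε : ℝ) (s : S) (M : Table S (Record S UUData)) (yes : Finset S) : Part ℝ :=
  if yes = ∅ then Part.some 0
  else
    let no' := cannotReach M yes
    let M₁ := M.modifyAll no' fun r =>
      { r with label := .no, data := { r.data with pNo := fun _ => 1 } }
    if no' = ∅ then Part.some 1
    else
      let yes' := cannotReach M₁ no'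
      let M₂ := M₁.modifyAll yes' fun r =>
        { r with label := .yes, data := { r.data with pYes := fun _ => 1 } }
      (uuLoop ε ⟨M₂, yes' ∪ no', 0⟩).map fun st => (st.M.val s).data.pYes (par st.i)

/-- `CheckUnboundedUntil`, with `check₁ = Check(·, Φ₁)` and `check₂ = Check(·, Φ₂)`. -/
def Interpreter.checkUnboundedUntil (I : Interpreter S AP) (ε : ℝ)
    (check₁ check₂ : S → Part Bool) (s : S) : Part ℝ :=
  (createUU check₁ check₂ s).bind fun r =>
    match r.label with
    | .yes => Part.some 1
    | .no => Part.some 0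
    | .unknown =>
      (I.expandUnbounded (createUU check₁ check₂) (ExpState.init s r)).bind fun st =>
        uuCompute ε s st.M st.yes

/-! ### `Check` and `CheckPath` -/

mutual
/-- `Check(s, Φ)`, with accuracy `ε` for unbounded until. -/
def Interpreter.check (I : Interpreter S AP) (ε : ℝ) : StateFormula AP → S → Part Bool
  | .atom a, s => Part.some (I.labEval s a)
  | .neg Φ, s => (I.check ε Φ s).map fun b => !b
  | .or Φ₁ Φ₂, s => (I.check ε Φ₁ s).bind fun b => if b then Part.some true else I.check ε Φ₂ s
  | .prob c p φ, s => (I.checkPath ε φ s).map fun q => decide (c.holds q p)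
/-- `CheckPath(s, φ)`, with accuracy `ε` for unbounded until. -/
def Interpreter.checkPath (I : Interpreter S AP) (ε : ℝ) : PathFormula AP → S → Part ℝ
  | .next Φ, s =>
    (I.next s).foldlM (fun (p : ℝ) x => (I.check ε Φ x.1).map fun b => if b then p + x.2 else p) 0
  | .boundedUntil Φ₁ k Φ₂, s => I.checkBoundedUntil (I.check ε Φ₁) (I.check ε Φ₂) k s
  | .unboundedUntil Φ₁ Φ₂, s => I.checkUnboundedUntil ε (I.check ε Φ₁) (I.check ε Φ₂) s
end

end PCTL

end

/-!
The proof has a probabilistic and an algorithmic half, which meet in the functions `untilVal`: the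
value `untilVal B₁ B₂ k s` is defined by the recursion over `k` that the backward iterations carry
out.

*Probability.* The Markov property of the path measure (`lintegral_pathMeasure_succ`) shows that
staying `n` steps in a set before entering another has as probability an iterate of a one-step
operator. Splitting the bounded until at the first visit to `B₂` gives `pr_boundedUntil`, and
continuity from below gives `tendsto_untilVal` for the unbounded one. Hence the probability `x` of an
unbounded until is the harmonic limit of the values `untilVal`. On a finite set, the minimum
principle `one_le_of_harmonic` then replaces all arguments about absorption.

*Expansion.* `ExpInv` states what the expansion phase maintains; its essential part is that the
lists of predecessors hold exactly the transitions from the expanded states. The number of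
unexpanded reachable states decreases in every round, whence termination.

*Computation.* By `PrecOf.relax`, one round of propagation along the lists of predecessors is one
averaging step. For bounded until, entry `i` of the arrays is `untilVal` with the expanded states
in place of `B₁`, and `k` rounds of expansion make this agree with the true value at the initial
state. For unbounded until, the states `N` relabelled `no` have `x = 0`, and the states `Y` relabelled
`yes` have `x = 1` and are the only ones with this value (`Resolved`). So reaching `Y` in `i` steps has
probability at most `x`, reaching `N` has probability at most `1 - x`, and when these add up to
`1 - ε` the first is within `ε` of `x`. They do so eventually, since the sum of their limits is
harmonic off `Y ∪ N` and hence `1`.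

*Recursion.* `decides_of_clauses` passes from the operands to the formula for every relation that
obeys the clauses of the satisfaction relation and agrees with the algorithm on unbounded until.
It is applied to `Sat`, where an approximation cannot cross a threshold further than `ε` away, and
to `ApproxSat`, where the computed numbers take the place of the probabilities of unbounded until.
-/

noncomputable section

namespace PCTL

open MeasureTheory ProbabilityTheory
open scoped Classical

universe u v

variable {S : Type u} {AP : Type v}

/-! ### One-step averages and step-bounded until probabilities -/

/-- The expectation of `f` after one step from `s`. -/
def Interpreter.expect (I : Interpreter S AP) (f : S → ℝ) (s : S) : ℝ :=
  ((I.next s).map fun x => x.2 * f x.1).sum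

/-- The probability of `B₁ U^{≤ k} B₂` from `s`, given by its recursion over `k`. -/
def Interpreter.untilVal (I : Interpreter S AP) (B₁ B₂ : S → Prop) : ℕ → S → ℝ
  | 0, s => if B₂ s then 1 else 0
  | k + 1, s => if B₂ s then 1 else if B₁ s then I.expect (I.untilVal B₁ B₂ k) s else 0

theorem Interpreter.expect_nonneg (I : Interpreter S AP) {f : S → ℝ} {s : S}
    (h : ∀ x ∈ I.next s, 0 ≤ f x.1) : 0 ≤ I.expect f s := by
  refine List.sum_nonneg fun y hy => ?_
  obtain ⟨x, hx, rfl⟩ := List.mem_map.1 hy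
  exact mul_nonneg (I.next_pos s x hx).le (h x hx)

theorem Interpreter.untilVal_nonneg (I : Interpreter S AP) (B₁ B₂ : S → Prop) (k : ℕ) (s : S) :
    0 ≤ I.untilVal B₁ B₂ k s := by
  induction k generalizing s with
  | zero => rw [untilVal]; split_ifs <;> norm_num
  | succ k ih =>
    rw [untilVal]
    split_ifs
    · norm_num
    · exact I.expect_nonneg fun x _ => ih x.1
    · exact le_rfl

theorem Interpreter.trans_pos_iff (I : Interpreter S AP) {s t : S} :
    0 < I.trans s t ↔ ∃ p, (t, p) ∈ I.next s := by
  constructor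
  · intro h
    by_contra! h'
    have : (I.next s).filter (fun x => x.1 = t) = [] := by
      rw [List.filter_eq_nil_iff]
      rintro ⟨a, p⟩ hx
      simp only [decide_eq_true_eq]
      rintro rfl
      exact h' p hx
    simp [trans, this] at h
  · rintro ⟨p, hp⟩
    have h1 : (t, p) ∈ (I.next s).filter (fun x => x.1 = t) := by simp [hp]
    refine lt_of_lt_of_le (I.next_pos s _ hp) (List.single_le_sum (l :=
      ((I.next s).filter (fun x => x.1 = t)).map Prod.snd) ?_ _ (List.mem_map.2 ⟨_, h1, rfl⟩))
    intro y hy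
    obtain ⟨x, hx, rfl⟩ := List.mem_map.1 hy
    exact (I.next_pos s x (List.mem_filter.1 hx).1).le

/-! ### The law of the paths -/

/-- The expectation after one step of a function with values in `[0, ∞]`. -/
def Interpreter.lexpect (I : Interpreter S AP) (f : S → ENNReal) (s : S) : ENNReal :=
  ((I.next s).map fun x => ENNReal.ofReal x.2 * f x.1).sum

theorem ofReal_list_sum {α : Type*} (l : List α) (f : α → ℝ) (h : ∀ x ∈ l, 0 ≤ f x) :
    ENNReal.ofReal (l.map f).sum = (l.map fun x => ENNReal.ofReal (f x)).sum := by
  induction l with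
  | nil => simp
  | cons x l ih =>
    rw [List.map_cons, List.sum_cons, ENNReal.ofReal_add (h x (by simp)), ih fun y hy =>
      h y (by simp [hy]), List.map_cons, List.sum_cons]
    refine List.sum_nonneg fun y hy => ?_
    obtain ⟨z, hz, rfl⟩ := List.mem_map.1 hy
    exact h z (by simp [hz])

theorem Interpreter.ofReal_expect (I : Interpreter S AP) {f : S → ℝ} {s : S}
    (h : ∀ x ∈ I.next s, 0 ≤ f x.1) :
    ENNReal.ofReal (I.expect f s) = I.lexpect (fun t => ENNReal.ofReal (f t)) s := by
  rw [expect, lexpect, ofReal_list_sum _ _ fun x hx => mul_nonneg (I.next_pos s x hx).le (h x hx)]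
  refine congrArg List.sum (List.map_congr_left fun x hx => ?_)
  rw [ENNReal.ofReal_mul (I.next_pos s x hx).le]

theorem Interpreter.lexpect_add (I : Interpreter S AP) (f g : S → ENNReal) (s : S) :
    I.lexpect (fun t => f t + g t) s = I.lexpect f s + I.lexpect g s := by
  simp only [lexpect, mul_add, List.sum_map_add]

theorem Interpreter.lintegral_stepKernel (I : Interpreter S AP) (g : S → ENNReal) (s : S) :
    letI : MeasurableSpace S := ⊤
    ∫⁻ y, g y ∂(I.stepKernel s) = I.lexpect g s := by
  let _ : MeasurableSpace S := ⊤
  change ∫⁻ y, g y ∂(listMeasure (I.next s)) = I.lexpect g s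
  rw [lexpect]
  induction I.next s with
  | nil => simp [listMeasure]
  | cons x l ih =>
    rw [listMeasure, lintegral_add_measure, ih, lintegral_smul_measure,
      lintegral_dirac' _ measurable_from_top]
    simp

theorem Interpreter.lintegral_pathMeasure_zero (I : Interpreter S AP) (s : S) (g : S → ENNReal) :
    ∫⁻ σ, g (σ 0) ∂(I.pathMeasure s) = g s := by
  let _ : MeasurableSpace S := ⊤
  have := I.isMarkovKernel_stepKernel
  have h := Kernel.traj_map_frestrictLe_apply (X := fun _ : ℕ => S)
    (κ := fun n => I.stepKernel.comap
      (fun h : (i : Finset.Iic n) → S => h ⟨n, Finset.mem_Iic.2 le_rfl⟩)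
      (measurable_pi_apply _)) 0 0 (fun _ => s)
  have hg : Measurable fun x : (i : Finset.Iic 0) → S => g (x ⟨0, Finset.mem_Iic.2 le_rfl⟩) :=
    (measurable_from_top (f := g)).comp (measurable_pi_apply _)
  have h2 := congrArg (fun m => ∫⁻ x, g (x ⟨0, Finset.mem_Iic.2 le_rfl⟩) ∂m) h
  rw [lintegral_map hg (by fun_prop), Kernel.partialTraj_self, Kernel.id_apply,
    lintegral_dirac' _ hg] at h2
  exact h2

/-- The Markov property at time `n`: given the states up to time `n`, the next state is distributed
according to `next`. -/
theorem Interpreter.lintegral_pathMeasure_succ (I : Interpreter S AP) (s : S) (n : ℕ)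
    (F : (Finset.Iic n → S) → ENNReal)
    (hF : letI : MeasurableSpace S := ⊤
      Measurable F) (g : S → ENNReal) :
    ∫⁻ σ, F (fun i => σ i) * g (σ (n + 1)) ∂(I.pathMeasure s) =
      ∫⁻ σ, F (fun i => σ i) * I.lexpect g (σ n) ∂(I.pathMeasure s) := by
  let _ : MeasurableSpace S := ⊤
  have := I.isMarkovKernel_stepKernel
  have h := Kernel.partialTraj_compProd_eq_map_traj (X := fun _ : ℕ => S)
    (κ := fun n => I.stepKernel.comap
      (fun h : (i : Finset.Iic n) → S => h ⟨n, Finset.mem_Iic.2 le_rfl⟩)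
      (measurable_pi_apply _)) (Nat.zero_le n) (x₀ := fun _ => s)
  rw [← Kernel.traj_map_frestrictLe_apply] at h
  have hF' : Measurable F := hF
  have hg : Measurable g := measurable_from_top
  have hm : Measurable fun z : (Finset.Iic n → S) × S => F z.1 * g z.2 :=
    (hF'.comp measurable_fst).mul (hg.comp measurable_snd)
  have h2 := congrArg (fun m => ∫⁻ z, F z.1 * g z.2 ∂m) h
  rw [lintegral_map hm (by fun_prop), Measure.lintegral_compProd hm,
    lintegral_map (hm.lintegral_kernel_prod_right') (by fun_prop)] at h2
  refine h2.symm.trans (lintegral_congr fun σ => ?_)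
  refine (lintegral_const_mul (μ := I.stepKernel (σ n)) (F fun i => σ i) hg).trans ?_
  rw [I.lintegral_stepKernel]

/-- The operator `f ↦ 1_C · P f`. -/
def Interpreter.stepIn (I : Interpreter S AP) (C : S → Prop) (f : S → ENNReal) (s : S) : ENNReal :=
  if C s then I.lexpect f s else 0

/-- Integrating out the last state turns `n` steps inside `C` followed by `g` into the `n`-th iterate
of `f ↦ 1_C · P f`. -/
theorem Interpreter.lintegral_stay (I : Interpreter S AP) (C : S → Prop) (s : S) (n : ℕ)
    (g : S → ENNReal) :
    ∫⁻ σ, (if ∀ i < n, C (σ i) then 1 else 0) * g (σ n) ∂(I.pathMeasure s) =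
      (I.stepIn C)^[n] g s := by
  induction n generalizing g with
  | zero => simp [I.lintegral_pathMeasure_zero]
  | succ n ih =>
    rw [Function.iterate_succ_apply, ← ih]
    have h := I.lintegral_pathMeasure_succ s n (fun x => if ∀ i, C (x i) then 1 else 0) (by
      let _ : MeasurableSpace S := ⊤
      refine Measurable.ite ?_ measurable_const measurable_const
      have : {x : Finset.Iic n → S | ∀ i, C (x i)} = ⋂ i, (fun x => x i) ⁻¹' {y | C y} := by
        ext; simp
      rw [this]
      exact MeasurableSet.iInter fun i => measurable_pi_apply i MeasurableSpace.measurableSet_top) g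
    have e : ∀ σ : ℕ → S, (∀ i : Finset.Iic n, C (σ i)) ↔ ∀ i < n + 1, C (σ i) := by
      intro σ
      simp
    simp only [e] at h
    rw [h]
    refine lintegral_congr fun σ => ?_
    rw [stepIn]
    by_cases h1 : ∀ i < n + 1, C (σ i)
    · rw [if_pos h1, if_pos fun i hi => h1 i (by omega), if_pos (h1 n (by omega))]
    · rw [if_neg h1]
      by_cases h2 : C (σ n)
      · rw [if_neg, zero_mul, zero_mul]
        contrapose! h1
        intro i hi
        rcases Nat.lt_succ_iff_lt_or_eq.1 hi with h | rfl
        · exact h1 i h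
        · exact h2
      · rw [if_neg h2]; simp

theorem measurableSet_coord (n : ℕ) (B : S → Prop) :
    @MeasurableSet (ℕ → S) (@MeasurableSpace.pi ℕ (fun _ => S) fun _ => ⊤) {σ | B (σ n)} := by
  let _ : MeasurableSpace S := ⊤
  exact (measurable_pi_apply n : Measurable fun σ : ℕ → S => σ n)
    (MeasurableSpace.measurableSet_top (s := {y | B y}))

theorem measurableSet_stay (n : ℕ) (C B : S → Prop) :
    @MeasurableSet (ℕ → S) (@MeasurableSpace.pi ℕ (fun _ => S) fun _ => ⊤)
      {σ | (∀ i < n, C (σ i)) ∧ B (σ n)} := by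
  let _ : MeasurableSpace S := ⊤
  refine MeasurableSet.inter ?_ (measurableSet_coord n B)
  have : {σ : ℕ → S | ∀ i < n, C (σ i)} = ⋂ i, ⋂ (_ : i < n), {σ | C (σ i)} := by
    ext; simp
  change MeasurableSet {σ : ℕ → S | ∀ i < n, C (σ i)}
  rw [this]
  exact MeasurableSet.iInter fun i => MeasurableSet.iInter fun _ => measurableSet_coord i C

theorem Interpreter.pathMeasure_stay (I : Interpreter S AP) (C B : S → Prop) (s : S) (n : ℕ) :
    I.pathMeasure s {σ | (∀ i < n, C (σ i)) ∧ B (σ n)} =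
      (I.stepIn C)^[n] (fun t => if B t then 1 else 0) s := by
  let _ : MeasurableSpace S := ⊤
  rw [← I.lintegral_stay, ← lintegral_indicator_one (measurableSet_stay n C B)]
  refine lintegral_congr fun σ => ?_
  by_cases h1 : ∀ i < n, C (σ i) <;> by_cases h2 : B (σ n) <;>
    simp [Set.indicator, h1, h2]

theorem Interpreter.pathMeasure_step_null (I : Interpreter S AP) (s a : S) (n : ℕ) (B : S → Prop)
    (h : ∀ x ∈ I.next a, ¬ B x.1) : I.pathMeasure s {σ | σ n = a ∧ B (σ (n + 1))} = 0 := by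
  let _ : MeasurableSpace S := ⊤
  have hm : MeasurableSet {σ : ℕ → S | σ n = a ∧ B (σ (n + 1))} :=
    (measurableSet_coord n (· = a)).inter (measurableSet_coord (n + 1) B)
  have h1 := I.lintegral_pathMeasure_succ s n
    (fun x => if x ⟨n, Finset.mem_Iic.2 le_rfl⟩ = a then 1 else 0)
    (by
      let _ : MeasurableSpace S := ⊤
      exact (measurable_from_top (f := fun y : S => if y = a then (1 : ENNReal) else 0)).comp
        (measurable_pi_apply _)) (fun t => if B t then 1 else 0)
  rw [← lintegral_indicator_one hm]
  have h2 : I.lexpect (fun t => if B t then 1 else 0) a = 0 := by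
    rw [lexpect]
    refine List.sum_eq_zero fun y hy => ?_
    obtain ⟨x, hx, rfl⟩ := List.mem_map.1 hy
    rw [if_neg (h x hx), mul_zero]
  refine Eq.trans (lintegral_congr fun σ => ?_) (h1.trans ?_)
  · by_cases h1 : σ n = a <;> by_cases h2 : B (σ (n + 1)) <;> simp [Set.indicator, h1, h2]
  · refine (lintegral_congr fun σ => ?_).trans lintegral_zero
    by_cases h1 : σ n = a
    · rw [h1, h2, mul_zero]
    · rw [if_neg h1, zero_mul]

/-- The terms that can be reached in exactly `n` steps. These lists are finite, so that null sets can
be added up over them even when `S` is uncountable. -/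
def Interpreter.layer (I : Interpreter S AP) (s : S) : ℕ → List S
  | 0 => [s]
  | n + 1 => (I.layer s n).flatMap fun a => (I.next a).map Prod.fst

theorem Interpreter.pathMeasure_layer (I : Interpreter S AP) (s : S) (n : ℕ) :
    I.pathMeasure s {σ | σ n ∉ I.layer s n} = 0 := by
  induction n with
  | zero =>
    have := I.pathMeasure_stay (fun _ => True) (fun t => t ∉ I.layer s 0) s 0
    simpa [layer] using this
  | succ n ih =>
    refine measure_mono_null (t := {σ | σ n ∉ I.layer s n} ∪ ⋃ a ∈ {a | a ∈ I.layer s n},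
      {σ | σ n = a ∧ σ (n + 1) ∉ I.layer s (n + 1)}) ?_ ?_
    · intro σ hσ
      by_cases h : σ n ∈ I.layer s n
      · right
        simp only [Set.mem_iUnion]
        exact ⟨σ n, h, rfl, hσ⟩
      · exact Or.inl h
    · rw [measure_union_null_iff]
      refine ⟨ih, (measure_biUnion_null_iff (List.finite_toSet _).countable).2 fun a ha => ?_⟩
      refine I.pathMeasure_step_null s a n (fun t => t ∉ I.layer s (n + 1)) fun x hx h => h ?_
      rw [layer]
      exact List.mem_flatMap.2 ⟨a, ha, List.mem_map.2 ⟨x, hx, rfl⟩⟩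

theorem Interpreter.pathMeasure_paths (I : Interpreter S AP) (s : S) :
    I.pathMeasure s (I.paths s)ᶜ = 0 := by
  refine measure_mono_null (t := {σ | σ 0 ∉ I.layer s 0} ∪ ⋃ n : ℕ,
    ({σ | σ n ∉ I.layer s n} ∪ ⋃ a ∈ {a | a ∈ I.layer s n},
      {σ | σ n = a ∧ ¬ 0 < I.trans a (σ (n + 1))})) ?_ ?_
  · intro σ hσ
    rw [Set.mem_compl_iff, paths, Set.mem_ofPred_eq, not_and_or] at hσ
    rcases hσ with h | h
    · left; simpa [layer] using h
    · push Not at h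
      obtain ⟨n, hn⟩ := h
      right
      refine Set.mem_iUnion.2 ⟨n, ?_⟩
      by_cases h : σ n ∈ I.layer s n
      · right
        simp only [Set.mem_iUnion]
        exact ⟨σ n, h, rfl, not_lt.2 hn⟩
      · exact Or.inl h
  · rw [measure_union_null_iff, measure_iUnion_null_iff]
    refine ⟨I.pathMeasure_layer s 0, fun n => ?_⟩
    rw [measure_union_null_iff]
    refine ⟨I.pathMeasure_layer s n,
      (measure_biUnion_null_iff (List.finite_toSet _).countable).2 fun a ha => ?_⟩
    exact I.pathMeasure_step_null s a n (fun t => ¬ 0 < I.trans a t) fun x hx h =>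
      h (I.trans_pos_iff.2 ⟨x.2, hx⟩)

/-- The restriction to `paths s` can be dropped. No measurability of the event is needed, since the
complement of `paths s` is null; this matters as `paths s` need not be measurable for the product of
discrete `σ`-algebras if `S` is very large. -/
theorem Interpreter.pr_eq (I : Interpreter S AP) (s : S) (E : (ℕ → S) → Prop) :
    I.pr s E = (I.pathMeasure s {σ | E σ}).toReal := by
  rw [pr]
  congr 1
  refine le_antisymm (measure_mono fun σ h => h.2) ?_
  calc I.pathMeasure s {σ | E σ}
      ≤ I.pathMeasure s ({σ | σ ∈ I.paths s ∧ E σ} ∪ (I.paths s)ᶜ) := by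
        refine measure_mono fun σ h => ?_
        by_cases h' : σ ∈ I.paths s
        · exact Or.inl ⟨h', h⟩
        · exact Or.inr h'
    _ ≤ _ := measure_union_le _ _
    _ = _ := by rw [I.pathMeasure_paths, add_zero]

theorem Interpreter.pr_next (I : Interpreter S AP) (s : S) (B : S → Prop) :
    I.pr s (fun σ => B (σ 1)) = I.expect (fun t => if B t then 1 else 0) s := by
  have h := I.pathMeasure_stay (fun _ => True) B s 1
  simp only [implies_true, true_and, Function.iterate_one, stepIn, if_true] at h
  rw [pr_eq, h, ← ENNReal.toReal_ofReal (r := I.expect _ s), ofReal_expect]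
  · congr 2
    ext t
    split_ifs <;> simp
  all_goals first
    | exact I.expect_nonneg fun x _ => by split_ifs <;> norm_num
    | exact fun x _ => by split_ifs <;> norm_num

theorem Interpreter.sum_stepIn (I : Interpreter S AP) (C : S → Prop) (f : ℕ → S → ENNReal) (k : ℕ)
    (s : S) : ∑ h ∈ Finset.range k, I.stepIn C (f h) s =
      I.stepIn C (fun t => ∑ h ∈ Finset.range k, f h t) s := by
  induction k with
  | zero =>
    simp [stepIn, lexpect]
  | succ k ih =>
    rw [Finset.sum_range_succ, ih]
    simp only [stepIn, Finset.sum_range_succ]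
    split_ifs
    · rw [I.lexpect_add]
    · simp

theorem Interpreter.pathMeasure_boundedUntil (I : Interpreter S AP) (B₁ B₂ : S → Prop) (k : ℕ)
    (s : S) : I.pathMeasure s {σ | BoundedUntilAlong B₁ k B₂ σ} =
      ENNReal.ofReal (I.untilVal B₁ B₂ k s) := by
  let _ : MeasurableSpace S := ⊤
  -- split the event according to the first visit to `B₂`
  have h1 : {σ | BoundedUntilAlong B₁ k B₂ σ} = ⋃ h ∈ Finset.range (k + 1),
      {σ : ℕ → S | (∀ i < h, B₁ (σ i) ∧ ¬ B₂ (σ i)) ∧ B₂ (σ h)} := by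
    ext σ
    simp only [Set.mem_iUnion, Set.mem_ofPred_eq, BoundedUntilAlong, Finset.mem_range]
    constructor
    · rintro ⟨h, hk, h2, h1⟩
      have hex : ∃ h, B₂ (σ h) := ⟨h, h2⟩
      have hle : Nat.find hex ≤ h := Nat.find_min' hex h2
      exact ⟨Nat.find hex, by omega, fun i hi => ⟨h1 i (by omega), Nat.find_min hex hi⟩,
        Nat.find_spec hex⟩
    · rintro ⟨h, hk, h1, h2⟩
      exact ⟨h, by omega, h2, fun i hi => (h1 i hi).1⟩
  rw [h1, measure_biUnion_finset]
  · rw [Finset.sum_congr rfl fun h _ => I.pathMeasure_stay (fun t => B₁ t ∧ ¬ B₂ t) B₂ s h]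
    clear h1
    induction k generalizing s with
    | zero =>
      rw [untilVal]
      simp only [zero_add, Finset.range_one, Finset.sum_singleton, Function.iterate_zero, id]
      split_ifs <;> simp
    | succ k ih =>
      rw [Finset.sum_range_succ']
      simp only [Function.iterate_succ_apply', Function.iterate_zero, id]
      rw [I.sum_stepIn]
      simp only [ih, untilVal, stepIn]
      by_cases h2 : B₂ s
      · simp [h2]
      · by_cases h1 : B₁ s
        · simp [h1, h2, I.ofReal_expect fun x _ => I.untilVal_nonneg B₁ B₂ k x.1]
        · simp [h1, h2]
  · intro a _ b _ hab
    refine Set.disjoint_left.2 fun σ ha hb => ?_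
    rcases lt_or_gt_of_ne hab with h | h
    · exact (hb.1 a h).2 ha.2
    · exact (ha.1 b h).2 hb.2
  · intro h _
    exact measurableSet_stay h (fun t => B₁ t ∧ ¬ B₂ t) B₂

theorem Interpreter.pr_boundedUntil (I : Interpreter S AP) (B₁ B₂ : S → Prop) (k : ℕ) (s : S) :
    I.pr s (BoundedUntilAlong B₁ k B₂) = I.untilVal B₁ B₂ k s := by
  rw [pr_eq, pathMeasure_boundedUntil, ENNReal.toReal_ofReal (I.untilVal_nonneg ..)]

theorem Interpreter.tendsto_untilVal (I : Interpreter S AP) (B₁ B₂ : S → Prop) (s : S) :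
    Filter.Tendsto (fun k => I.untilVal B₁ B₂ k s) Filter.atTop
      (nhds (I.pr s (UntilAlong B₁ B₂))) := by
  let _ : MeasurableSpace S := ⊤
  have hP : IsProbabilityMeasure (I.pathMeasure s) := by
    have := I.isMarkovKernel_stepKernel
    unfold pathMeasure
    infer_instance
  have h1 : {σ | UntilAlong B₁ B₂ σ} = ⋃ k, {σ | BoundedUntilAlong B₁ k B₂ σ} := by
    ext σ
    simp only [Set.mem_iUnion, Set.mem_ofPred_eq, BoundedUntilAlong, UntilAlong]
    constructor
    · rintro ⟨k, h⟩
      exact ⟨k, k, le_rfl, h⟩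
    · rintro ⟨_, k, _, h⟩
      exact ⟨k, h⟩
  simp only [← pr_boundedUntil, pr_eq]
  rw [h1]
  refine (ENNReal.tendsto_toReal (measure_ne_top _ _)).comp (tendsto_measure_iUnion_atTop ?_)
  rintro a b hab σ ⟨h, hk, hh⟩
  exact ⟨h, hk.trans hab, hh⟩

/-! ### Until probabilities as harmonic functions -/

theorem Interpreter.expect_mono (I : Interpreter S AP) {f g : S → ℝ} {s : S}
    (h : ∀ x ∈ I.next s, f x.1 ≤ g x.1) : I.expect f s ≤ I.expect g s :=
  List.sum_le_sum fun x hx => mul_le_mul_of_nonneg_left (h x hx) (I.next_pos s x hx).le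

theorem Interpreter.expect_congr (I : Interpreter S AP) {f g : S → ℝ} {s : S}
    (h : ∀ x ∈ I.next s, f x.1 = g x.1) : I.expect f s = I.expect g s :=
  le_antisymm (I.expect_mono fun x hx => (h x hx).le) (I.expect_mono fun x hx => (h x hx).ge)

theorem Interpreter.expect_const (I : Interpreter S AP) (c : ℝ) (s : S) :
    I.expect (fun _ => c) s = c := by
  rw [expect, List.sum_map_mul_right, I.next_sum, one_mul]

theorem Interpreter.expect_add (I : Interpreter S AP) (f g : S → ℝ) (s : S) :
    I.expect (fun t => f t + g t) s = I.expect f s + I.expect g s := by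
  simp only [expect, mul_add, List.sum_map_add]

theorem Interpreter.expect_sub (I : Interpreter S AP) (f g : S → ℝ) (s : S) :
    I.expect (fun t => f t - g t) s = I.expect f s - I.expect g s := by
  rw [eq_sub_iff_add_eq, ← I.expect_add]
  simp

theorem Interpreter.mul_le_expect (I : Interpreter S AP) {f : S → ℝ} {s : S}
    (h : ∀ x ∈ I.next s, 0 ≤ f x.1) {x : S × ℝ} (hx : x ∈ I.next s) :
    x.2 * f x.1 ≤ I.expect f s := by
  refine List.single_le_sum (fun y hy => ?_) _ (List.mem_map.2 ⟨x, hx, rfl⟩)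
  obtain ⟨z, hz, rfl⟩ := List.mem_map.1 hy
  exact mul_nonneg (I.next_pos s z hz).le (h z hz)

theorem Interpreter.tendsto_expect (I : Interpreter S AP) {f : ℕ → S → ℝ} {g : S → ℝ} {s : S}
    (h : ∀ x ∈ I.next s, Filter.Tendsto (fun k => f k x.1) Filter.atTop (nhds (g x.1))) :
    Filter.Tendsto (fun k => I.expect (f k) s) Filter.atTop (nhds (I.expect g s)) :=
  tendsto_list_sum _ fun x hx => (h x hx).const_mul x.2

theorem Interpreter.untilVal_le_one (I : Interpreter S AP) (B₁ B₂ : S → Prop) (k : ℕ) (s : S) :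
    I.untilVal B₁ B₂ k s ≤ 1 := by
  induction k generalizing s with
  | zero => rw [untilVal]; split_ifs <;> norm_num
  | succ k ih =>
    rw [untilVal]
    split_ifs
    · norm_num
    · exact (I.expect_mono fun x _ => ih x.1).trans (I.expect_const 1 s).le
    · norm_num

theorem Interpreter.untilVal_of_right (I : Interpreter S AP) {B₁ B₂ : S → Prop} {k : ℕ} {s : S}
    (h : B₂ s) : I.untilVal B₁ B₂ k s = 1 := by
  cases k <;> simp [untilVal, h]

theorem Interpreter.untilVal_of_not (I : Interpreter S AP) {B₁ B₂ : S → Prop} {k : ℕ} {s : S}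
    (h₁ : ¬ B₁ s) (h₂ : ¬ B₂ s) : I.untilVal B₁ B₂ k s = 0 := by
  cases k <;> simp [untilVal, h₁, h₂]

theorem Interpreter.untilVal_mono (I : Interpreter S AP) (B₁ B₂ : S → Prop) (s : S) :
    Monotone fun k => I.untilVal B₁ B₂ k s := by
  refine monotone_nat_of_le_succ fun k => ?_
  induction k generalizing s with
  | zero =>
    by_cases h : B₂ s
    · simp only [I.untilVal_of_right h, le_refl]
    · have := I.untilVal_nonneg B₁ B₂ 1 s
      simpa [untilVal, h] using this
  | succ k ih =>
    rw [untilVal, untilVal]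
    split_ifs
    · exact le_rfl
    · exact I.expect_mono fun x _ => ih x.1
    · exact le_rfl

/-- A set without goal states, closed under the steps of its `B₁`-states, is never left towards
a goal. -/
theorem Interpreter.untilVal_eq_zero (I : Interpreter S AP) {B₁ B₂ Z : S → Prop}
    (h₂ : ∀ s, Z s → ¬ B₂ s) (h₁ : ∀ s, Z s → B₁ s → ∀ x ∈ I.next s, Z x.1) (k : ℕ) {s : S}
    (hs : Z s) : I.untilVal B₁ B₂ k s = 0 := by
  induction k generalizing s with
  | zero => simp [untilVal, h₂ s hs]
  | succ k ih =>
    rw [untilVal, if_neg (h₂ s hs)]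
    split_ifs with h
    · rw [I.expect_congr (g := fun _ => 0) fun x hx => ih (h₁ s hs h x hx), I.expect_const]
    · rfl

/-- Probability of `B₁ U B₂` from `s`. -/
def Interpreter.untilPr (I : Interpreter S AP) (B₁ B₂ : S → Prop) (s : S) : ℝ :=
  I.pr s (UntilAlong B₁ B₂)

section
variable (I : Interpreter S AP) (B₁ B₂ : S → Prop)

theorem Interpreter.untilVal_le_untilPr (k : ℕ) (s : S) :
    I.untilVal B₁ B₂ k s ≤ I.untilPr B₁ B₂ s :=
  (I.untilVal_mono B₁ B₂ s).ge_of_tendsto (I.tendsto_untilVal B₁ B₂ s) k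

theorem Interpreter.untilPr_nonneg (s : S) : 0 ≤ I.untilPr B₁ B₂ s :=
  (I.untilVal_nonneg B₁ B₂ 0 s).trans (I.untilVal_le_untilPr B₁ B₂ 0 s)

theorem Interpreter.untilPr_le_one (s : S) : I.untilPr B₁ B₂ s ≤ 1 :=
  le_of_tendsto' (I.tendsto_untilVal B₁ B₂ s) fun k => I.untilVal_le_one B₁ B₂ k s

variable {B₁ B₂}

theorem Interpreter.untilPr_of_right {s : S} (h : B₂ s) : I.untilPr B₁ B₂ s = 1 :=
  tendsto_nhds_unique (I.tendsto_untilVal B₁ B₂ s) (by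
    simp only [I.untilVal_of_right h]; exact tendsto_const_nhds)

theorem Interpreter.untilPr_of_not {s : S} (h₁ : ¬ B₁ s) (h₂ : ¬ B₂ s) :
    I.untilPr B₁ B₂ s = 0 :=
  tendsto_nhds_unique (I.tendsto_untilVal B₁ B₂ s) (by
    simp only [I.untilVal_of_not h₁ h₂]; exact tendsto_const_nhds)

theorem Interpreter.untilPr_harmonic {s : S} (h₁ : B₁ s) (h₂ : ¬ B₂ s) :
    I.untilPr B₁ B₂ s = I.expect (I.untilPr B₁ B₂) s := by
  refine tendsto_nhds_unique ((I.tendsto_untilVal B₁ B₂ s).comp (Filter.tendsto_add_atTop_nat 1)) ?_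
  simp only [Function.comp_def, untilVal, h₁, h₂, if_true, if_false]
  exact I.tendsto_expect fun x _ => I.tendsto_untilVal B₁ B₂ x.1

theorem Interpreter.untilPr_eq_zero {Z : S → Prop}
    (h₂ : ∀ s, Z s → ¬ B₂ s) (h₁ : ∀ s, Z s → B₁ s → ∀ x ∈ I.next s, Z x.1) {s : S}
    (hs : Z s) : I.untilPr B₁ B₂ s = 0 :=
  tendsto_nhds_unique (I.tendsto_untilVal B₁ B₂ s) (by
    simp only [I.untilVal_eq_zero h₂ h₁ _ hs]; exact tendsto_const_nhds)

end

/-- One step of positive probability from a state of `U`. -/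
def Interpreter.Edge (I : Interpreter S AP) (U : Finset S) (a b : S) : Prop :=
  a ∈ U ∧ ∃ p, (b, p) ∈ I.next a

/-- Positivity of a nonnegative superharmonic function propagates backwards along paths. -/
theorem Interpreter.pos_of_reach (I : Interpreter S AP) {U : Finset S} {f : S → ℝ}
    (h0 : ∀ s, 0 ≤ f s) (hU : ∀ s ∈ U, I.expect f s ≤ f s) {s t : S}
    (hst : Relation.ReflTransGen (I.Edge U) s t) (ht : 0 < f t) : 0 < f s := by
  induction hst using Relation.ReflTransGen.head_induction_on with
  | refl => exact ht
  | head hab _ ih =>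
    obtain ⟨ha, p, hp⟩ := hab
    exact (mul_pos (I.next_pos _ _ hp) ih).trans_le
      ((I.mul_le_expect (fun x _ => h0 x.1) hp).trans (hU _ ha))

/-- Minimum principle: a function on a finite set that is harmonic where it is below `1`, is at
least `1`, if every state of the set reaches a state with value at least `1`. -/
theorem Interpreter.one_le_of_harmonic (I : Interpreter S AP) {K U : Finset S} {f : S → ℝ}
    (hK : ∀ s ∈ K, 1 ≤ f s ∨ ((∀ x ∈ I.next s, x.1 ∈ K) ∧ f s = I.expect f s))
    (hreach : ∀ s ∈ K, ∃ t, 1 ≤ f t ∧ Relation.ReflTransGen (I.Edge U) s t) :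
    ∀ s ∈ K, 1 ≤ f s := by
  intro s hs
  obtain ⟨m, hm, hmin⟩ := K.exists_min_image f ⟨s, hs⟩
  refine le_trans ?_ (hmin s hs)
  by_contra! hlt
  obtain ⟨t, ht, hmt⟩ := hreach m hm
  have key : ∀ b, Relation.ReflTransGen (I.Edge U) m b → b ∈ K ∧ f b = f m := by
    intro b hb
    induction hb with
    | refl => exact ⟨hm, rfl⟩
    | @tail b c _ hbc ih =>
      obtain ⟨hb, hfb⟩ := ih
      obtain ⟨-, p, hp⟩ := hbc
      rcases hK b hb with h | ⟨hn, he⟩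
      · linarith
      · refine ⟨hn _ hp, ?_⟩
        -- the average of `f - f m ≥ 0` over the successors of `b` is `0`
        have h1 := I.mul_le_expect (f := fun x => f x - f m) (s := b)
          (fun x hx => sub_nonneg.2 (hmin _ (hn x hx))) hp
        rw [I.expect_sub f (fun _ => f m), I.expect_const, ← he, hfb, sub_self] at h1
        have h2 := hmin _ (hn _ hp)
        have h3 := I.next_pos _ _ hp
        simp only at h1 h2 h3
        by_contra h4
        have : 0 < f c - f m := sub_pos.2 (lt_of_le_of_ne h2 (Ne.symm h4))
        have := mul_pos h3 this
        linarith
  have := (key t hmt).2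
  linarith

/-! ### Partial computations -/

theorem dom_bind {α β : Type*} {p : Part α} {f : α → Part β} (hp : p.Dom)
    (hf : ∀ a ∈ p, (f a).Dom) : (p.bind f).Dom := by
  obtain ⟨a, ha⟩ := Part.dom_iff_mem.1 hp
  obtain ⟨b, hb⟩ := Part.dom_iff_mem.1 (hf a ha)
  exact Part.dom_iff_mem.2 ⟨b, Part.mem_bind_iff.2 ⟨a, ha, hb⟩⟩

theorem mem_foldlM_cons {α β : Type*} {f : β → α → Part β} {a : α} {l : List α} {b c : β} :
    c ∈ (a :: l).foldlM f b ↔ ∃ b' ∈ f b a, c ∈ l.foldlM f b' := by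
  rw [List.foldlM_cons]
  exact Part.mem_bind_iff

theorem mem_foldlM_nil {α β : Type*} {f : β → α → Part β} {b c : β} :
    c ∈ ([] : List α).foldlM f b ↔ c = b := by
  rw [List.foldlM_nil]
  exact Part.mem_some_iff

/-- Invariants of a monadic fold; `P l b` refers to the list `l` of the elements processed so far,
the last one first. -/
theorem foldlM_invariant {α β : Type*} {f : β → α → Part β} {l : List α} (P : List α → β → Prop)
    (step : ∀ l' b, ∀ a ∈ l, P l' b → ∀ b' ∈ f b a, P (a :: l') b') {b c : β} (l₀ : List α)
    (h : P l₀ b) (hc : c ∈ l.foldlM f b) : P (l.reverse ++ l₀) c := by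
  induction l generalizing b l₀ with
  | nil =>
    rw [mem_foldlM_nil] at hc
    rw [hc]; exact h
  | cons a l ih =>
    obtain ⟨b', hb', hc⟩ := mem_foldlM_cons.1 hc
    have := ih (fun l' b x hx => step l' b x (by simp [hx])) (a :: l₀)
      (step l₀ b a (by simp) h b' hb') hc
    simpa using this

theorem foldlM_dom {α β : Type*} {f : β → α → Part β} {l : List α} (P : List α → β → Prop)
    (step : ∀ l' b, ∀ a ∈ l, P l' b → ∀ b' ∈ f b a, P (a :: l') b')
    (dom : ∀ l' b, ∀ a ∈ l, P l' b → (f b a).Dom) {b : β} (l₀ : List α)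
    (h : P l₀ b) : (l.foldlM f b).Dom := by
  induction l generalizing b l₀ with
  | nil => exact Part.dom_iff_mem.2 ⟨b, mem_foldlM_nil.2 rfl⟩
  | cons a l ih =>
    rw [List.foldlM_cons]
    exact dom_bind (dom l₀ b a (by simp) h) fun b' hb' =>
      ih (fun l' b x hx => step l' b x (by simp [hx]))
        (fun l' b x hx => dom l' b x (by simp [hx])) (a :: l₀) (step l₀ b a (by simp) h b' hb')

theorem mem_whileLoop {X : Type*} {cond : X → Prop} {body : X → Part X} {x y : X} :
    y ∈ whileLoop cond body x ↔
      (¬ cond x ∧ y = x) ∨ (cond x ∧ ∃ x' ∈ body x, y ∈ whileLoop cond body x') := by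
  refine PFun.mem_fix_iff.trans ?_
  change (_ ∨ ∃ x', _ ∧ y ∈ whileLoop cond body x') ↔ _
  by_cases h : cond x <;> simp [h]

theorem whileLoop_invariant {X : Type*} {cond : X → Prop} {body : X → Part X} (P : X → Prop)
    (step : ∀ x, P x → cond x → ∀ x' ∈ body x, P x') {x y : X} (hx : P x)
    (hy : y ∈ whileLoop cond body x) : P y ∧ ¬ cond y := by
  revert hx
  refine PFun.fixInduction (C := fun x => P x → P y ∧ ¬ cond y) hy fun x hy ih hx => ?_
  rcases mem_whileLoop.1 hy with ⟨h, rfl⟩ | ⟨h, x', hx', -⟩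
  · exact ⟨hx, h⟩
  · refine ih x' ?_ (step x hx h x' hx')
    simp [h, hx']

theorem whileLoop_dom {X : Type*} {cond : X → Prop} {body : X → Part X} (P : X → Prop) (m : X → ℕ)
    (step : ∀ x, P x → cond x → (body x).Dom ∧ ∀ x' ∈ body x, P x' ∧ m x' < m x) {x : X}
    (hx : P x) : (whileLoop cond body x).Dom := by
  induction hm : m x using Nat.strong_induction_on generalizing x with
  | _ n ih =>
    rw [Part.dom_iff_mem]
    by_cases h : cond x
    · obtain ⟨hd, hs⟩ := step x hx h
      obtain ⟨x', hx'⟩ := Part.dom_iff_mem.1 hd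
      obtain ⟨hp, hlt⟩ := hs x' hx'
      obtain ⟨y, hy⟩ := Part.dom_iff_mem.1 (ih (m x') (hm ▸ hlt) hp rfl)
      exact ⟨y, mem_whileLoop.2 (Or.inr ⟨h, x', hx', hy⟩)⟩
    · exact ⟨x, mem_whileLoop.2 (Or.inl ⟨h, rfl⟩)⟩

/-! ### Labels -/

/-- The label of a state if `B₁` and `B₂` are the satisfaction sets of the operands. -/
def labelOf (B₁ B₂ : S → Prop) (t : S) : Label :=
  if B₂ t then .yes else if B₁ t then .unknown else .no

theorem labelOf_eq_yes {B₁ B₂ : S → Prop} {t : S} : labelOf B₁ B₂ t = .yes ↔ B₂ t := by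
  unfold labelOf; split_ifs <;> simp_all

theorem labelOf_eq_unknown {B₁ B₂ : S → Prop} {t : S} :
    labelOf B₁ B₂ t = .unknown ↔ B₁ t ∧ ¬ B₂ t := by
  unfold labelOf; split_ifs <;> simp_all

/-- `check` decides `B` at `t` if it terminates there. -/
def Decides (check : S → Part Bool) (B : S → Prop) (t : S) : Prop :=
  ∀ b ∈ check t, (b = true ↔ B t)

theorem computeLabel_spec {check₁ check₂ : S → Part Bool} {B₁ B₂ : S → Prop} {t : S}
    (h₁ : Decides check₁ B₁ t) (h₂ : Decides check₂ B₂ t) {l : Label}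
    (hl : l ∈ computeLabel check₁ check₂ t) : l = labelOf B₁ B₂ t := by
  obtain ⟨b, hb, hl⟩ := Part.mem_bind_iff.1 hl
  have := h₂ b hb
  cases b
  · simp only [Bool.false_eq_true, if_false] at hl
    obtain ⟨c, hc, rfl⟩ := (Part.mem_map_iff _).1 hl
    have := h₁ c hc
    cases c <;> simp_all [labelOf]
  · simp_all [labelOf]

theorem computeLabel_dom {check₁ check₂ : S → Part Bool} {t : S} (h₁ : (check₁ t).Dom)
    (h₂ : (check₂ t).Dom) : (computeLabel check₁ check₂ t).Dom := by
  refine dom_bind h₂ fun b _ => ?_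
  cases b
  · exact h₁
  · trivial

/-- The initial data of the records for bounded until. -/
def buInit (k : ℕ) : Label → BUData
  | .yes => fun i => if i ≤ k then 1 else 0
  | _ => fun _ => 0

/-- The initial data of the records for unbounded until. -/
def uuInit : Label → UUData
  | .yes => ⟨fun _ => 1, fun _ => 0⟩
  | .no => ⟨fun _ => 0, fun _ => 1⟩
  | .unknown => ⟨fun _ => 0, fun _ => 0⟩

theorem createBU_eq (check₁ check₂ : S → Part Bool) (k : ℕ) (t : S) :
    createBU check₁ check₂ k t =
      (computeLabel check₁ check₂ t).map fun l => ⟨[], l, buInit k l⟩ := by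
  rw [createBU]
  congr 1
  funext l
  cases l <;> rfl

theorem createUU_eq (check₁ check₂ : S → Part Bool) (t : S) :
    createUU check₁ check₂ t =
      (computeLabel check₁ check₂ t).map fun l => ⟨[], l, uuInit l⟩ := by
  rw [createUU]
  congr 1
  funext l
  cases l <;> rfl

/-! ### The expansion phase -/

/-- The transitions listed by `next` at the states of `U`, as triples of source, target and
probability. -/
def Interpreter.edges (I : Interpreter S AP) (U : Finset S) : Multiset (S × S × ℝ) :=
  ∑ r ∈ U, ((I.next r).map fun x => (r, x.1, x.2) : Multiset (S × S × ℝ))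

theorem Interpreter.mem_edges (I : Interpreter S AP) {U : Finset S} {e : S × S × ℝ} :
    e ∈ I.edges U ↔ e.1 ∈ U ∧ e.2 ∈ I.next e.1 := by
  obtain ⟨a, b, p⟩ := e
  simp only [edges, Multiset.mem_sum, Multiset.mem_coe, List.mem_map, Prod.mk.injEq, Prod.exists]
  constructor
  · rintro ⟨r, hr, c, q, h, rfl, rfl, rfl⟩
    exact ⟨hr, h⟩
  · rintro ⟨hr, h⟩
    exact ⟨a, hr, b, p, h, rfl, rfl, rfl⟩

/-- The invariant of the expansion phase started in `s`, where `lab` is the correct labelling, `ini`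
gives the initial data, `E` holds the transitions that have been entered into the lists of
predecessors, and `U` the states that have been expanded or are being expanded. -/
structure ExpInv {D : Type} (I : Interpreter S AP) (s : S) (lab : S → Label) (ini : Label → D)
    (E : Multiset (S × S × ℝ)) (U : Finset S) (st : ExpState S D) : Prop where
  start : s ∈ st.M.keys
  reach : ∀ t ∈ st.M.keys, I.Reachable s t
  label : ∀ t ∈ st.M.keys, (st.M.val t).label = lab t
  data : ∀ t ∈ st.M.keys, (st.M.val t).data = ini (lab t)
  yes : ∀ t, t ∈ st.yes ↔ t ∈ st.M.keys ∧ lab t = .yes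
  unknown : ∀ t, t ∈ U ∨ t ∈ st.toExpand ↔ t ∈ st.M.keys ∧ lab t = .unknown
  disjoint : Disjoint U st.toExpand
  target : ∀ e ∈ E, e.2.1 ∈ st.M.keys
  prec : ∀ t, ((st.M.val t).prec : Multiset (S × ℝ)) =
    (E.filter fun e => e.2.1 = t).map fun e => (e.1, e.2.2)

section
variable {D : Type} {I : Interpreter S AP} {s : S} {lab : S → Label} {ini : Label → D}
  {E : Multiset (S × S × ℝ)} {U : Finset S} {st : ExpState S D} {create : S → Part (Record S D)}

theorem ExpInv.init (h : lab s = .unknown) :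
    ExpInv I s lab ini (I.edges ∅) ∅ (ExpState.init s ⟨[], lab s, ini (lab s)⟩) where
  start := by simp [ExpState.init, Table.single]
  reach := by
    simp only [ExpState.init, Table.single, Finset.mem_singleton]
    rintro t rfl
    exact Relation.ReflTransGen.refl
  label := by simp [ExpState.init, Table.single]
  data := by simp [ExpState.init, Table.single]
  yes := by
    simp only [ExpState.init, Table.single, Finset.notMem_empty, Finset.mem_singleton, false_iff]
    rintro t ⟨rfl, ht⟩
    simp [h] at ht
  unknown := by
    simp only [ExpState.init, Table.single, Finset.notMem_empty, Finset.mem_singleton, false_or]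
    intro t
    exact ⟨fun ht => ⟨ht, ht ▸ h⟩, fun ht => ht.1⟩
  disjoint := by simp
  target := by simp [Interpreter.edges]
  prec := by simp [ExpState.init, Table.single, Interpreter.edges]

theorem ExpInv.discover (hcreate : ∀ t, I.Reachable s t → ∀ r ∈ create t,
    r = ⟨[], lab t, ini (lab t)⟩) (h : ExpInv I s lab ini E U st) {t : S} (ht : I.Reachable s t)
    {st' : ExpState S D} (hst' : st' ∈ discover create t st) :
    ExpInv I s lab ini E U st' ∧ t ∈ st'.M.keys := by
  rw [PCTL.discover] at hst'
  split_ifs at hst' with hk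
  · rw [Part.mem_some_iff] at hst'
    subst hst'
    exact ⟨h, hk⟩
  · obtain ⟨r, hr, rfl⟩ := (Part.mem_map_iff _).1 hst'
    rw [hcreate t ht r hr]
    have hU : t ∉ U := fun h' => hk ((h.unknown t).1 (Or.inl h')).1
    have hprec0 : (E.filter fun e => e.2.1 = t) = 0 := by
      rw [Multiset.filter_eq_nil]
      rintro e he rfl
      exact hk (h.target e he)
    -- the part of the invariant that concerns the table alone
    have hM : ∀ M', M' = st.M.insert t (⟨[], lab t, ini (lab t)⟩ : Record S D) →
        s ∈ M'.keys ∧ (∀ a ∈ M'.keys, I.Reachable s a) ∧ (∀ a ∈ M'.keys, (M'.val a).label = lab a) ∧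
        (∀ a ∈ M'.keys, (M'.val a).data = ini (lab a)) ∧ (∀ e ∈ E, e.2.1 ∈ M'.keys) ∧
        (∀ a, ((M'.val a).prec : Multiset (S × ℝ)) =
          (E.filter fun e => e.2.1 = a).map fun e => (e.1, e.2.2)) ∧ t ∈ M'.keys ∧
        ∀ a, a ∈ M'.keys ↔ a = t ∨ a ∈ st.M.keys := by
      rintro _ rfl
      simp only [Table.insert, Finset.mem_insert, true_or, implies_true, and_true]
      refine ⟨Or.inr h.start, ?_, ?_, ?_, fun e he => Or.inr (h.target e he), ?_⟩
      · rintro a (rfl | ha)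
        exacts [ht, h.reach a ha]
      · intro a ha
        by_cases hat : a = t
        · subst hat; simp
        · simp [Function.update_of_ne hat, h.label a (ha.resolve_left hat)]
      · intro a ha
        by_cases hat : a = t
        · subst hat; simp
        · simp [Function.update_of_ne hat, h.data a (ha.resolve_left hat)]
      · intro a
        by_cases hat : a = t
        · subst hat; simp [hprec0]
        · simp only [Function.update_of_ne hat, h.prec a]
    obtain ⟨m1, m2, m3, m4, m5, m6, m7, m8⟩ := hM _ rfl
    cases hl : lab t
    all_goals
      simp only [hl] at m1 m2 m3 m4 m5 m6 m7 m8
      refine ⟨⟨m1, m2, m3, m4, ?_, ?_, ?_, m5, m6⟩, m7⟩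
    · intro a
      simp only [Finset.mem_insert, m8, h.yes]
      constructor
      · rintro (rfl | ⟨h1, h2⟩)
        exacts [⟨Or.inl rfl, hl⟩, ⟨Or.inr h1, h2⟩]
      · rintro ⟨rfl | h1, h2⟩
        exacts [Or.inl rfl, Or.inr ⟨h1, h2⟩]
    · intro a
      simp only [m8, h.unknown]
      constructor
      · rintro ⟨h1, h2⟩
        exact ⟨Or.inr h1, h2⟩
      · rintro ⟨rfl | h1, h2⟩
        · simp [hl] at h2
        · exact ⟨h1, h2⟩
    · exact h.disjoint
    · intro a
      simp only [m8, h.yes]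
      constructor
      · rintro ⟨h1, h2⟩
        exact ⟨Or.inr h1, h2⟩
      · rintro ⟨rfl | h1, h2⟩
        · simp [hl] at h2
        · exact ⟨h1, h2⟩
    · intro a
      simp only [m8, h.unknown]
      constructor
      · rintro ⟨h1, h2⟩
        exact ⟨Or.inr h1, h2⟩
      · rintro ⟨rfl | h1, h2⟩
        · simp [hl] at h2
        · exact ⟨h1, h2⟩
    · exact h.disjoint
    · intro a
      simp only [m8, h.yes]
      constructor
      · rintro ⟨h1, h2⟩
        exact ⟨Or.inr h1, h2⟩
      · rintro ⟨rfl | h1, h2⟩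
        · simp [hl] at h2
        · exact ⟨h1, h2⟩
    · intro a
      simp only [m8, Finset.mem_insert]
      constructor
      · rintro (h1 | rfl | h1)
        · have := (h.unknown a).1 (Or.inl h1)
          exact ⟨Or.inr this.1, this.2⟩
        · exact ⟨Or.inl rfl, hl⟩
        · have := (h.unknown a).1 (Or.inr h1)
          exact ⟨Or.inr this.1, this.2⟩
      · rintro ⟨rfl | h1, h2⟩
        · exact Or.inr (Or.inl rfl)
        · exact ((h.unknown a).2 ⟨h1, h2⟩).imp_right Or.inr
    · rw [Finset.disjoint_insert_right]
      exact ⟨hU, h.disjoint⟩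

theorem ExpInv.visit (hcreate : ∀ t, I.Reachable s t → ∀ r ∈ create t,
    r = ⟨[], lab t, ini (lab t)⟩) (h : ExpInv I s lab ini E U st) {r : S} {x : S × ℝ}
    (hx : I.Reachable s x.1) {st' : ExpState S D} (hst' : st' ∈ visit create r st x) :
    ExpInv I s lab ini ((r, x.1, x.2) ::ₘ E) U st' := by
  obtain ⟨st₁, h₁, rfl⟩ := (Part.mem_map_iff _).1 hst'
  obtain ⟨h, hk⟩ := h.discover hcreate hx h₁
  refine ⟨h.start, h.reach, ?_, ?_, h.yes, h.unknown, h.disjoint, ?_, ?_⟩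
  · intro t ht
    by_cases htx : t = x.1
    · subst htx; simp [Table.modify, h.label _ hk]
    · simpa [Table.modify, Function.update_of_ne htx] using h.label t ht
  · intro t ht
    by_cases htx : t = x.1
    · subst htx; simp [Table.modify, h.data _ hk]
    · simpa [Table.modify, Function.update_of_ne htx] using h.data t ht
  · intro e he
    rcases Multiset.mem_cons.1 he with rfl | he
    exacts [hk, h.target e he]
  · intro t
    by_cases htx : t = x.1
    · subst htx
      simp [Table.modify, ← h.prec]
    · rw [Multiset.filter_cons_of_neg (p := fun e : S × S × ℝ => e.2.1 = t) _ (Ne.symm htx), ← h.prec]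
      simp [Table.modify, Function.update_of_ne htx]

theorem ExpInv.foldlM_visit (hcreate : ∀ t, I.Reachable s t → ∀ r ∈ create t,
    r = ⟨[], lab t, ini (lab t)⟩) (h : ExpInv I s lab ini E U st) {r : S} (hr : I.Reachable s r)
    {st' : ExpState S D} (hst' : st' ∈ (I.next r).foldlM (PCTL.visit create r) st) :
    ExpInv I s lab ini (((I.next r).map fun x => (r, x.1, x.2) : Multiset (S × S × ℝ)) + E)
      U st' := by
  have := foldlM_invariant
    (fun l st => ExpInv I s lab ini (((l.map fun x => (r, x.1, x.2) : List _) :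
      Multiset (S × S × ℝ)) + E) U st)
    (fun l st x hx h st' hst' => by
      have := h.visit hcreate (hr.tail (I.trans_pos_iff.2 ⟨x.2, hx⟩)) hst'
      simpa [← Multiset.cons_coe, Multiset.cons_add] using this) [] (by simpa using h) hst'
  convert this using 2
  rw [List.append_nil, List.map_reverse, Multiset.coe_reverse]

theorem ExpInv.foldlM_visit_dom (hcreate : ∀ t, I.Reachable s t → ∀ r ∈ create t,
    r = ⟨[], lab t, ini (lab t)⟩) (hdom : ∀ t, I.Reachable s t → (create t).Dom)
    (h : ExpInv I s lab ini E U st) {r : S} (hr : I.Reachable s r) :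
    ((I.next r).foldlM (PCTL.visit create r) st).Dom := by
  have hstep : ∀ x ∈ I.next r, I.Reachable s x.1 := fun x hx =>
    hr.tail (I.trans_pos_iff.2 ⟨x.2, hx⟩)
  refine foldlM_dom (fun _ st => ∃ E, ExpInv I s lab ini E U st)
    (fun l st x hx ⟨E, h⟩ st' hst' => ⟨_, h.visit hcreate (hstep x hx) hst'⟩)
    (fun l st x hx _ => ?_) [] ⟨E, h⟩
  change (PCTL.discover create x.1 st).Dom
  rw [PCTL.discover]
  split_ifs
  · trivial
  · exact hdom _ (hstep x hx)

theorem ExpInv.clear (h : ExpInv I s lab ini E U st) :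
    ExpInv I s lab ini E (U ∪ st.toExpand) { st with toExpand := ∅ } :=
  ⟨h.start, h.reach, h.label, h.data, h.yes, fun t => by simp [← h.unknown], by simp, h.target,
    h.prec⟩

theorem ExpInv.expandRound (hcreate : ∀ t, I.Reachable s t → ∀ r ∈ create t,
    r = ⟨[], lab t, ini (lab t)⟩) (h : ExpInv I s lab ini (I.edges U) U st)
    {st' : ExpState S D} (hst' : st' ∈ I.expandRound create st) :
    ExpInv I s lab ini (I.edges (U ∪ st.toExpand)) (U ∪ st.toExpand) st' := by
  have hr : ∀ r ∈ st.toExpand.toList, I.Reachable s r := fun r hr =>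
    h.reach r ((h.unknown r).1 (Or.inr (Finset.mem_toList.1 hr))).1
  have := foldlM_invariant
    (fun l st' => ExpInv I s lab ini ((l.map fun r => ((I.next r).map fun x => (r, x.1, x.2) :
      Multiset (S × S × ℝ))).sum + I.edges U) (U ∪ st.toExpand) st')
    (fun l st r hr' h st' hst' => by
      have := h.foldlM_visit hcreate (hr r hr') hst'
      simpa [add_assoc] using this) [] (by simpa using h.clear) hst'
  convert this using 1
  rw [List.append_nil, List.map_reverse, List.sum_reverse, Finset.sum_map_toList, add_comm]
  exact Finset.sum_union h.disjoint

theorem ExpInv.expandRound_dom (hcreate : ∀ t, I.Reachable s t → ∀ r ∈ create t,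
    r = ⟨[], lab t, ini (lab t)⟩) (hdom : ∀ t, I.Reachable s t → (create t).Dom)
    (h : ExpInv I s lab ini E U st) : (I.expandRound create st).Dom := by
  have hr : ∀ r ∈ st.toExpand.toList, I.Reachable s r := fun r hr =>
    h.reach r ((h.unknown r).1 (Or.inr (Finset.mem_toList.1 hr))).1
  exact foldlM_dom (fun _ st' => ∃ E, ExpInv I s lab ini E (U ∪ st.toExpand) st')
    (fun l st r hr' ⟨E, h⟩ st' hst' => ⟨_, h.foldlM_visit hcreate (hr r hr') hst'⟩)
    (fun l st r hr' ⟨E, h⟩ => h.foldlM_visit_dom hcreate hdom (hr r hr')) [] ⟨E, h.clear⟩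

/-- The states from which no path of fewer than `n` steps through `unknown` states leads to a state
that has not been expanded. -/
def Interpreter.Explored (I : Interpreter S AP) (lab : S → Label) (U : Finset S) : ℕ → S → Prop
  | 0, _ => True
  | n + 1, t => lab t = .unknown → t ∈ U ∧ ∀ x ∈ I.next t, I.Explored lab U n x.1

/-- Each round expands all states that were unexpanded at its beginning, so that `n` rounds explore
at least `n` steps from every state that was known before them. -/
theorem ExpInv.expandBounded (hcreate : ∀ t, I.Reachable s t → ∀ r ∈ create t,
    r = ⟨[], lab t, ini (lab t)⟩) (n : ℕ) (h : ExpInv I s lab ini (I.edges U) U st)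
    {st' : ExpState S D} (hst' : st' ∈ I.expandBounded create n st) :
    ∃ U', U ⊆ U' ∧ ExpInv I s lab ini (I.edges U') U' st' ∧
      ∀ t ∈ st.M.keys, I.Explored lab U' n t := by
  induction n generalizing U st with
  | zero =>
    rw [Interpreter.expandBounded, Part.mem_some_iff] at hst'
    subst hst'
    exact ⟨U, subset_rfl, h, fun t _ => trivial⟩
  | succ n ih =>
    rw [Interpreter.expandBounded] at hst'
    split_ifs at hst' with hT
    · rw [Part.mem_some_iff] at hst'
      subst hst'
      refine ⟨U, subset_rfl, h, ?_⟩
      generalize n + 1 = m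
      induction m with
      | zero => exact fun t _ => trivial
      | succ m ihm =>
        intro t ht hl
        have htU : t ∈ U := by
          have := (h.unknown t).2 ⟨ht, hl⟩
          simpa [hT] using this
        exact ⟨htU, fun x hx => ihm _ (h.target (t, x.1, x.2) (I.mem_edges.2 ⟨htU, hx⟩))⟩
    · obtain ⟨st₁, h₁, hst'⟩ := Part.mem_bind_iff.1 hst'
      have h2 := h.expandRound hcreate h₁
      obtain ⟨U', hU, h', hex⟩ := ih h2 hst'
      refine ⟨U', Finset.subset_union_left.trans hU, h', fun t ht hl => ?_⟩
      have htU : t ∈ U ∪ st.toExpand := Finset.mem_union.2 ((h.unknown t).2 ⟨ht, hl⟩)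
      exact ⟨hU htU, fun x hx => hex _ (h2.target (t, x.1, x.2) (I.mem_edges.2 ⟨htU, hx⟩))⟩

theorem ExpInv.expandBounded_dom (hcreate : ∀ t, I.Reachable s t → ∀ r ∈ create t,
    r = ⟨[], lab t, ini (lab t)⟩) (hdom : ∀ t, I.Reachable s t → (create t).Dom) (n : ℕ)
    (h : ExpInv I s lab ini (I.edges U) U st) : (I.expandBounded create n st).Dom := by
  induction n generalizing U st with
  | zero => trivial
  | succ n ih =>
    rw [Interpreter.expandBounded]
    split_ifs
    · trivial
    · exact dom_bind (h.expandRound_dom hcreate hdom) fun st₁ h₁ => ih (h.expandRound hcreate h₁)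

theorem ExpInv.expandUnbounded (hcreate : ∀ t, I.Reachable s t → ∀ r ∈ create t,
    r = ⟨[], lab t, ini (lab t)⟩) (h : ExpInv I s lab ini (I.edges U) U st)
    {st' : ExpState S D} (hst' : st' ∈ I.expandUnbounded create st) :
    ∃ U', ExpInv I s lab ini (I.edges U') U' st' ∧ st'.toExpand = ∅ := by
  have := whileLoop_invariant (fun st => ∃ U, ExpInv I s lab ini (I.edges U) U st)
    (fun st ⟨U, h⟩ _ st' hst' => ⟨_, h.expandRound hcreate hst'⟩) ⟨U, h⟩ hst'
  obtain ⟨⟨U', h'⟩, h2⟩ := this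
  exact ⟨U', h', not_not.1 h2⟩

theorem ExpInv.expandUnbounded_dom (hcreate : ∀ t, I.Reachable s t → ∀ r ∈ create t,
    r = ⟨[], lab t, ini (lab t)⟩) (hdom : ∀ t, I.Reachable s t → (create t).Dom)
    (hfin : {t | I.Reachable s t}.Finite) (h : ExpInv I s lab ini (I.edges U) U st) :
    (I.expandUnbounded create st).Dom := by
  -- every round moves the nonempty set `toExpand` to the expanded states
  refine whileLoop_dom (fun st => ∃ U, ExpInv I s lab ini (I.edges U) U st)
    (fun st => (hfin.toFinset \ (st.M.keys.filter fun t => lab t = .unknown ∧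
      t ∉ st.toExpand)).card) (fun st ⟨U, h⟩ hT => ?_) ⟨U, h⟩
  refine ⟨h.expandRound_dom hcreate hdom, fun st' hst' => ?_⟩
  have h' := h.expandRound hcreate hst'
  refine ⟨⟨_, h'⟩, Finset.card_lt_card ?_⟩
  have key : ∀ {U : Finset S} {E} {st : ExpState S D}, ExpInv I s lab ini E U st →
      (st.M.keys.filter fun t => lab t = .unknown ∧ t ∉ st.toExpand) = U := by
    intro U E st h
    ext t
    rw [Finset.mem_filter, ← and_assoc, ← h.unknown]
    constructor
    · rintro ⟨h1 | h1, h2⟩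
      exacts [h1, absurd h1 h2]
    · exact fun h1 => ⟨Or.inl h1, Finset.disjoint_left.1 h.disjoint h1⟩
  rw [key h, key h']
  obtain ⟨t, ht⟩ := Finset.nonempty_iff_ne_empty.2 hT
  refine Finset.ssubset_iff_of_subset
    (Finset.sdiff_subset_sdiff subset_rfl Finset.subset_union_left) |>.2 ⟨t, ?_, ?_⟩
  · rw [Finset.mem_sdiff]
    exact ⟨hfin.mem_toFinset.2 (h.reach t ((h.unknown t).1 (Or.inr ht)).1),
      Finset.disjoint_right.1 h.disjoint ht⟩
  · simp [ht]

end

/-! ### Backward propagation along the lists of predecessors -/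

/-- For every entry `(a, p)` of the list of predecessors of `r`, update the record of `a` by means of
`p` and the data of `r`. -/
def relax {D : Type} (g : ℝ → D → Record S D → Record S D) (M : Table S (Record S D)) (r : S) :
    Table S (Record S D) :=
  (M.val r).prec.foldl (fun M' x => M'.modify x.1 (g x.2 (M'.val r).data)) M

section
variable {D : Type} {g : ℝ → D → Record S D → Record S D}

theorem foldl_modify_invariant {α : Type*} (φ : Record S D → α) (hφ : ∀ p d r, φ (g p d r) = φ r)
    (L : List (S × ℝ)) (r t : S) (M : Table S (Record S D)) :
    φ ((L.foldl (fun M' x => M'.modify x.1 (g x.2 (M'.val r).data)) M).val t) = φ (M.val t) := by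
  induction L generalizing M with
  | nil => rfl
  | cons x L ih =>
    rw [List.foldl_cons, ih]
    by_cases h : t = x.1
    · subst h; simp [Table.modify, hφ]
    · simp [Table.modify, Function.update_of_ne h]

theorem foldl_relax_invariant {α : Type*} (φ : Record S D → α) (hφ : ∀ p d r, φ (g p d r) = φ r)
    (l : List S) (t : S) (M : Table S (Record S D)) :
    φ ((l.foldl (relax g) M).val t) = φ (M.val t) := by
  induction l generalizing M with
  | nil => rfl
  | cons r l ih =>
    rw [List.foldl_cons, ih]
    exact foldl_modify_invariant φ hφ _ r t M

theorem foldl_relax_keys (l : List S) (M : Table S (Record S D)) :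
    (l.foldl (relax g) M).keys = M.keys := by
  have h : ∀ (L : List (S × ℝ)) (r : S) (M : Table S (Record S D)),
      (L.foldl (fun M' x => M'.modify x.1 (g x.2 (M'.val r).data)) M).keys = M.keys := by
    intro L r
    induction L with
    | nil => exact fun _ => rfl
    | cons x L ih => exact fun M => ih _
  induction l generalizing M with
  | nil => rfl
  | cons r l ih =>
    rw [List.foldl_cons, ih]
    exact h _ r M

variable (ρ : D → ℝ) (ω : Record S D → ℝ) (act : Record S D → Prop)

theorem foldl_modify_add (hρ : ∀ p d r, ρ (g p d r).data = ρ r.data)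
    (hact : ∀ p d r, act (g p d r) = act r)
    (hω : ∀ p d r, ω (g p d r) = ω r + if act r then p * ρ d else 0)
    (L : List (S × ℝ)) (r t : S) (M : Table S (Record S D)) :
    ω ((L.foldl (fun M' x => M'.modify x.1 (g x.2 (M'.val r).data)) M).val t) = ω (M.val t) +
      (L.map fun x => if x.1 = t ∧ act (M.val t) then x.2 * ρ (M.val r).data else 0).sum := by
  induction L generalizing M with
  | nil => simp
  | cons x L ih =>
    have h1 := foldl_modify_invariant (g := g) act hact [x] r t M
    have h2 := foldl_modify_invariant (g := g) (fun r => ρ r.data) hρ [x] r r M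
    simp only [List.foldl_cons, List.foldl_nil] at h1 h2
    rw [List.foldl_cons, ih, h1, h2, List.map_cons, List.sum_cons, ← add_assoc]
    congr 1
    by_cases h : x.1 = t
    · subst h; simp [Table.modify, hω]
    · simp [Table.modify, Function.update_of_ne (Ne.symm h), h]

/-- `ω` is the entry of a record that is being written, for the records satisfying `act`, and `ρ` the
entry that is being read. As writing does not disturb reading, the order of the updates is
irrelevant. -/
theorem foldl_relax_add (hρ : ∀ p d r, ρ (g p d r).data = ρ r.data)
    (hact : ∀ p d r, act (g p d r) = act r) (hprec : ∀ p d r, (g p d r).prec = r.prec)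
    (hω : ∀ p d r, ω (g p d r) = ω r + if act r then p * ρ d else 0)
    (l : List S) (t : S) (M : Table S (Record S D)) :
    ω ((l.foldl (relax g) M).val t) = ω (M.val t) + (l.map fun r => ((M.val r).prec.map fun x =>
      if x.1 = t ∧ act (M.val t) then x.2 * ρ (M.val r).data else 0).sum).sum := by
  induction l generalizing M with
  | nil => simp
  | cons r l ih =>
    have h1 := foldl_relax_invariant (g := g) act hact [r] t M
    have h2 := fun a => foldl_relax_invariant (g := g) (fun r => ρ r.data) hρ [r] a M
    have h3 := fun a => foldl_relax_invariant (g := g) (fun r => r.prec) hprec [r] a M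
    simp only [List.foldl_cons, List.foldl_nil] at h1 h2 h3
    simp only [List.foldl_cons, ih, h1, h2, h3, List.map_cons, List.sum_cons]
    rw [← add_assoc]
    congr 1
    exact foldl_modify_add ρ ω act hρ hact hω _ r t M

end

/-- The lists of predecessors in `M` hold exactly the transitions from the states of `U`. -/
def Interpreter.PrecOf {D : Type} (I : Interpreter S AP) (U : Finset S)
    (M : Table S (Record S D)) : Prop :=
  ∀ t, ((M.val t).prec : Multiset (S × ℝ)) =
    ((I.edges U).filter fun e => e.2.1 = t).map fun e => (e.1, e.2.2)

section
variable {D : Type} {I : Interpreter S AP} {U : Finset S} {M : Table S (Record S D)}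

theorem Interpreter.PrecOf.prec_iff (h : I.PrecOf U M) {a b : S} :
    Prec M a b ↔ I.Edge U a b := by
  have hm : ∀ p, (a, p) ∈ (M.val b).prec ↔ a ∈ U ∧ (b, p) ∈ I.next a := by
    intro p
    rw [← Multiset.mem_coe, h b]
    simp only [Multiset.mem_map, Multiset.mem_filter, I.mem_edges, Prod.exists, Prod.mk.injEq]
    constructor
    · rintro ⟨c, d, q, ⟨⟨h1, h2⟩, rfl⟩, rfl, rfl⟩
      exact ⟨h1, h2⟩
    · rintro ⟨h1, h2⟩
      exact ⟨a, b, p, ⟨⟨h1, h2⟩, rfl⟩, rfl, rfl⟩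
  simp only [Prec, hm, Interpreter.Edge]
  constructor
  · rintro ⟨p, -, h1, h2⟩
    exact ⟨h1, p, h2⟩
  · rintro ⟨h1, p, h2⟩
    exact ⟨p, I.next_pos _ _ h2, h1, h2⟩

theorem Interpreter.PrecOf.mem_precClosure (h : I.PrecOf U M) {A : Finset S} {t : S} :
    t ∈ precClosure M A ↔ t ∈ M.keys ∧ (t ∈ A ∨ ∃ r ∈ A, I.Edge U t r) := by
  rw [precClosure, Finset.mem_filter]
  simp only [h.prec_iff]
  refine and_congr_right fun _ => ⟨?_, ?_⟩
  · rintro ⟨r, hr, rfl | h⟩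
    exacts [Or.inl hr, Or.inr ⟨r, hr, h⟩]
  · rintro (ht | ⟨r, hr, h⟩)
    exacts [⟨t, ht, Or.inl rfl⟩, ⟨r, hr, Or.inr h⟩]

theorem Interpreter.PrecOf.mem_cannotReach (h : I.PrecOf U M) {A : Finset S} {t : S} :
    t ∈ cannotReach M A ↔ t ∈ M.keys ∧ ¬ ∃ r ∈ A, Relation.ReflTransGen (I.Edge U) t r := by
  have : Prec M = I.Edge U := by
    funext a b; exact propext h.prec_iff
  rw [cannotReach, Finset.mem_filter, this]

theorem sum_filter_target (A : Finset S) (E : Multiset (S × S × ℝ)) (f : S × S × ℝ → ℝ) :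
    ∑ r ∈ A, ((E.filter fun e => e.2.1 = r).map f).sum =
      (E.map fun e => if e.2.1 ∈ A then f e else 0).sum := by
  induction E using Multiset.induction with
  | empty => simp
  | cons e E ih =>
    rw [Multiset.map_cons, Multiset.sum_cons, ← ih]
    have : ∀ r, (((e ::ₘ E).filter fun e => e.2.1 = r).map f).sum =
        (if e.2.1 = r then f e else 0) + ((E.filter fun e => e.2.1 = r).map f).sum := by
      intro r
      by_cases h : e.2.1 = r
      · rw [Multiset.filter_cons_of_pos (p := fun e : S × S × ℝ => e.2.1 = r) _ h]
        simp [h]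
      · rw [Multiset.filter_cons_of_neg (p := fun e : S × S × ℝ => e.2.1 = r) _ h]
        simp [h]
    simp only [this, Finset.sum_add_distrib, Finset.sum_ite_eq]

theorem Interpreter.sum_edges (I : Interpreter S AP) (U : Finset S) (f : S × S × ℝ → ℝ) :
    ((I.edges U).map f).sum = ∑ r ∈ U, ((I.next r).map fun x => f (r, x.1, x.2)).sum := by
  induction U using Finset.induction_on with
  | empty => simp [edges]
  | insert a U ha ih =>
    rw [edges, Finset.sum_insert ha, Multiset.map_add, Multiset.sum_add, Finset.sum_insert ha, ← ih,
      edges]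
    simp [Function.comp_def]

/-- Summing over the predecessor lists of `A` amounts to averaging over the transitions that
lead into `A`. -/
theorem Interpreter.PrecOf.sum_prec (h : I.PrecOf U M) (A : Finset S) (t : S) (c : Prop)
    (w : S → ℝ) :
    (A.toList.map fun r => ((M.val r).prec.map fun x =>
      if x.1 = t ∧ c then x.2 * w r else 0).sum).sum =
      if t ∈ U ∧ c then I.expect (fun r => if r ∈ A then w r else 0) t else 0 := by
  rw [Finset.sum_map_toList]
  have h1 : ∀ r, ((M.val r).prec.map fun x => if x.1 = t ∧ c then x.2 * w r else 0).sum =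
      (((I.edges U).filter fun e => e.2.1 = r).map
        fun e => if e.1 = t ∧ c then e.2.2 * w e.2.1 else 0).sum := by
    intro r
    rw [← Multiset.sum_coe, ← Multiset.map_coe, h r, Multiset.map_map]
    refine congrArg Multiset.sum (Multiset.map_congr rfl fun e he => ?_)
    rw [← (Multiset.mem_filter.1 he).2]
    rfl
  simp only [h1]
  rw [sum_filter_target, I.sum_edges]
  have h2 : ∀ r, ((I.next r).map fun x => if x.1 ∈ A then if r = t ∧ c then x.2 * w x.1 else 0
      else 0).sum = if r = t then if c then I.expect (fun r => if r ∈ A then w r else 0) t else 0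
      else 0 := by
    intro r
    by_cases hr : r = t
    · subst hr
      by_cases hc : c
      · simp [hc, expect]
      · simp [hc]
    · simp [hr]
  simp only [h2, Finset.sum_ite_eq']
  rw [ite_and]

/-- The effect of one round of backward propagation from the states of `A`. -/
theorem Interpreter.PrecOf.relax {g : ℝ → D → Record S D → Record S D} (h : I.PrecOf U M)
    (ρ : D → ℝ) (ω : Record S D → ℝ) (act : Record S D → Prop)
    (hρ : ∀ p d r, ρ (g p d r).data = ρ r.data)
    (hact : ∀ p d r, act (g p d r) = act r) (hprec : ∀ p d r, (g p d r).prec = r.prec)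
    (hω : ∀ p d r, ω (g p d r) = ω r + if act r then p * ρ d else 0) (A : Finset S) (t : S) :
    ω ((A.toList.foldl (PCTL.relax g) M).val t) = ω (M.val t) +
      if t ∈ U ∧ act (M.val t) then I.expect (fun r => if r ∈ A then ρ (M.val r).data else 0) t
      else 0 := by
  rw [foldl_relax_add ρ ω act hρ hact hprec hω, h.sum_prec]

theorem Interpreter.PrecOf.foldl_relax {g : ℝ → D → Record S D → Record S D} (h : I.PrecOf U M)
    (hprec : ∀ p d r, (g p d r).prec = r.prec) (l : List S) :
    I.PrecOf U (l.foldl (PCTL.relax g) M) := by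
  intro t
  rw [foldl_relax_invariant (fun r => r.prec) hprec, h t]

end

/-! ### Bounded until -/

/-- The backward iterations compute the values with `U` in place of `B₁`; after `n` steps the
unexpanded states do not matter yet. -/
theorem Interpreter.untilVal_of_explored (I : Interpreter S AP) {B₁ B₂ : S → Prop} {U : Finset S}
    (hU : ∀ t ∈ U, labelOf B₁ B₂ t = .unknown) (n : ℕ) {t : S}
    (h : I.Explored (labelOf B₁ B₂) U n t) :
    I.untilVal (· ∈ U) B₂ n t = I.untilVal B₁ B₂ n t := by
  induction n generalizing t with
  | zero => rfl
  | succ n ih =>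
    rw [untilVal, untilVal]
    by_cases h₂ : B₂ t
    · simp [h₂]
    by_cases h₁ : B₁ t
    · obtain ⟨htU, hn⟩ := h (labelOf_eq_unknown.2 ⟨h₁, h₂⟩)
      simp only [h₁, h₂, htU, if_true, if_false]
      exact I.expect_congr fun x hx => ih (hn x hx)
    · have : t ∉ U := fun ht => h₁ (labelOf_eq_unknown.1 (hU t ht)).1
      simp [h₁, h₂, this]

/-- The invariant of the computation phase for bounded until, after `i` of the `k` iterations. The set
`A` of the algorithm, here `st.2`, contains all states with a nonzero `i`-th entry. -/
structure BUInv (I : Interpreter S AP) (B₁ B₂ : S → Prop) (K U : Finset S) (k i : ℕ)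
    (st : Table S (Record S BUData) × Finset S) : Prop where
  keys : st.1.keys = K
  prec : I.PrecOf U st.1
  done : ∀ t ∈ K, ∀ j ≤ i, (st.1.val t).data j = I.untilVal (· ∈ U) B₂ j t
  todo : ∀ t ∈ K, ∀ j > i, (st.1.val t).data j = buInit k (labelOf B₁ B₂ t) j
  right : ∀ t ∈ K, B₂ t → t ∈ st.2
  support : ∀ t ∈ K, I.untilVal (· ∈ U) B₂ i t ≠ 0 → t ∈ st.2

theorem BUInv.step {I : Interpreter S AP} {B₁ B₂ : S → Prop} {K U : Finset S} {k i : ℕ}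
    {st : Table S (Record S BUData) × Finset S}
    (hUK : ∀ t ∈ U, ∀ x ∈ I.next t, x.1 ∈ K) (hU : ∀ t ∈ U, labelOf B₁ B₂ t = .unknown)
    (hi : i + 1 ≤ k) (h : BUInv I B₁ B₂ K U k i st) :
    BUInv I B₁ B₂ K U k (i + 1) (buIter st (i + 1)) := by
  let g : ℝ → BUData → Record S BUData → Record S BUData := fun p d r' =>
    { r' with data := Function.update r'.data (i + 1) (r'.data (i + 1) + p * d i) }
  have hg : buUpdate (S := S) (i + 1) = relax g := rfl
  have hit : buIter st (i + 1) = (st.2.toList.foldl (relax g) st.1,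
    precClosure (st.2.toList.foldl (relax g) st.1) st.2) := rfl
  have hkeys : (st.2.toList.foldl (relax g) st.1).keys = K := by
    rw [foldl_relax_keys, h.keys]
  have hprec : I.PrecOf U (st.2.toList.foldl (relax g) st.1) :=
    h.prec.foldl_relax (g := g) (fun _ _ _ => rfl) _
  have hother : ∀ t j, j ≠ i + 1 →
      ((st.2.toList.foldl (relax g) st.1).val t).data j = (st.1.val t).data j := by
    intro t j hj
    exact foldl_relax_invariant (g := g) (fun r => r.data j) (fun p d r => by simp [g, hj]) _ _ _
  rw [hit]
  refine ⟨hkeys, hprec, ?_, ?_, ?_, ?_⟩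
  · intro t ht j hj
    rcases Nat.lt_or_eq_of_le hj with hj | rfl
    · rw [hother t j (by omega)]
      exact h.done t ht j (by omega)
    · have h1 := h.prec.relax (g := g) (fun d => d i) (fun r => r.data (i + 1)) (fun _ => True)
        (fun p d r => by simp [g]) (fun _ _ _ => rfl) (fun _ _ _ => rfl)
        (fun p d r => by simp [g]) st.2 t
      simp only at h1 ⊢
      -- entry `i + 1` still has its initial value, which is `0` at the states of `U`
      rw [h1, h.todo t ht _ (Nat.lt_succ_self i)]
      by_cases htU : t ∈ U
      · have hl := hU t htU
        simp only [hl, htU, buInit, zero_add, and_self, if_true,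
          Interpreter.untilVal, (labelOf_eq_unknown.1 hl).2, if_false]
        refine I.expect_congr fun x hx => ?_
        split_ifs with hxA
        · exact h.done _ (hUK t htU x hx) i le_rfl
        · by_contra hne
          exact hxA (h.support _ (hUK t htU x hx) (Ne.symm hne))
      · simp only [htU, false_and, if_false, add_zero, Interpreter.untilVal]
        by_cases h₂ : B₂ t
        · simp [labelOf_eq_yes.2 h₂, buInit, h₂, hi]
        · have : labelOf B₁ B₂ t ≠ .yes := fun h => h₂ (labelOf_eq_yes.1 h)
          cases hl : labelOf B₁ B₂ t <;> simp_all [buInit]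
  · intro t ht j hj
    rw [hother t j (by omega)]
    exact h.todo t ht j (by omega)
  · intro t ht h₂
    rw [hprec.mem_precClosure, hkeys]
    exact ⟨ht, Or.inl (h.right t ht h₂)⟩
  · intro t ht hne
    rw [hprec.mem_precClosure, hkeys]
    refine ⟨ht, ?_⟩
    by_cases h₂ : B₂ t
    · exact Or.inl (h.right t ht h₂)
    · right
      rw [Interpreter.untilVal, if_neg h₂] at hne
      split_ifs at hne with htU
      · by_contra! hall
        refine hne (List.sum_eq_zero fun y hy => ?_)
        obtain ⟨x, hx, rfl⟩ := List.mem_map.1 hy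
        have : I.untilVal (· ∈ U) B₂ i x.1 = 0 := by
          by_contra h0
          exact hall x.1 (h.support x.1 (hUK t htU x hx) h0) ⟨htU, x.2, hx⟩
        rw [this, mul_zero]
      · exact absurd rfl hne

section
variable {I : Interpreter S AP} {B₁ B₂ : S → Prop} {check₁ check₂ : S → Part Bool} {s : S}

theorem Interpreter.createBU_spec (h₁ : ∀ t, I.Reachable s t → Decides check₁ B₁ t)
    (h₂ : ∀ t, I.Reachable s t → Decides check₂ B₂ t) (k : ℕ) (t : S) (ht : I.Reachable s t)
    (r : Record S BUData) (hr : r ∈ createBU check₁ check₂ k t) :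
    r = ⟨[], labelOf B₁ B₂ t, buInit k (labelOf B₁ B₂ t)⟩ := by
  rw [createBU_eq] at hr
  obtain ⟨l, hl, rfl⟩ := (Part.mem_map_iff _).1 hr
  rw [computeLabel_spec (h₁ t ht) (h₂ t ht) hl]

theorem Interpreter.checkBoundedUntil_spec (h₁ : ∀ t, I.Reachable s t → Decides check₁ B₁ t)
    (h₂ : ∀ t, I.Reachable s t → Decides check₂ B₂ t) {k : ℕ} {q : ℝ}
    (hq : q ∈ I.checkBoundedUntil check₁ check₂ k s) : q = I.pr s (BoundedUntilAlong B₁ k B₂) := by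
  rw [I.pr_boundedUntil]
  have hcr := I.createBU_spec h₁ h₂ k
  obtain ⟨r, hr, hq⟩ := Part.mem_bind_iff.1 hq
  have hr := hcr s Relation.ReflTransGen.refl r hr
  subst hr
  cases hl : labelOf B₁ B₂ s
  · rw [hl] at hq
    rw [Part.mem_some_iff.1 hq, I.untilVal_of_right (labelOf_eq_yes.1 hl)]
  · rw [hl] at hq
    rw [Part.mem_some_iff.1 hq, I.untilVal_of_not]
    · exact fun h => by simp only [labelOf, h] at hl; split_ifs at hl
    · exact fun h => by simp [labelOf, h] at hl
  · have h0 := ExpInv.init (I := I) (ini := buInit k) hl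
    have hq : q ∈ (I.expandBounded (createBU check₁ check₂ k) k (ExpState.init s
        ⟨[], labelOf B₁ B₂ s, buInit k (labelOf B₁ B₂ s)⟩)).map fun st =>
        if st.yes = ∅ then 0
        else (((List.range' 1 k).foldl buIter (st.M, st.yes)).1.val s).data k := by
      simpa only [hl] using hq
    obtain ⟨st, hst, rfl⟩ := (Part.mem_map_iff _).1 hq
    obtain ⟨U, -, h, hex⟩ := ExpInv.expandBounded hcr k h0 hst
    have hU : ∀ t ∈ U, labelOf B₁ B₂ t = .unknown := fun t ht => ((h.unknown t).1 (Or.inl ht)).2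
    have hUK : ∀ t ∈ U, ∀ x ∈ I.next t, x.1 ∈ st.M.keys := fun t ht x hx =>
      h.target (t, x.1, x.2) (I.mem_edges.2 ⟨ht, hx⟩)
    rw [← I.untilVal_of_explored hU k (hex s (by simp [ExpState.init, Table.single]))]
    have hY : ∀ t ∈ st.M.keys, B₂ t → t ∈ st.yes := fun t ht h₂ =>
      (h.yes t).2 ⟨ht, labelOf_eq_yes.2 h₂⟩
    split_ifs with hyes
    · refine (I.untilVal_eq_zero (Z := (· ∈ st.M.keys)) (fun t ht h₂ => ?_)
        (fun t _ htU => hUK t htU) k h.start).symm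
      simpa [hyes] using hY t ht h₂
    · have inv : ∀ n ≤ k, BUInv I B₁ B₂ st.M.keys U k n
          ((List.range' 1 n).foldl buIter (st.M, st.yes)) := by
        intro n
        induction n with
        | zero =>
          intro _
          refine ⟨rfl, h.prec, ?_, fun t ht j _ => congrFun (h.data t ht) j, hY, ?_⟩
          · intro t ht j hj
            obtain rfl : j = 0 := by omega
            have := congrFun (h.data t ht) 0
            rw [List.range'_zero, List.foldl_nil, this, untilVal]
            by_cases h₂ : B₂ t
            · simp [labelOf_eq_yes.2 h₂, buInit, h₂]
            · have : labelOf B₁ B₂ t ≠ .yes := fun h => h₂ (labelOf_eq_yes.1 h)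
              cases hl : labelOf B₁ B₂ t <;> simp_all [buInit]
          · intro t ht hne
            by_cases h₂ : B₂ t
            · exact hY t ht h₂
            · simp [untilVal, h₂] at hne
        | succ n ih =>
          intro hn
          rw [List.range'_1_concat, List.foldl_append, List.foldl_cons, List.foldl_nil, add_comm 1 n]
          exact (ih (by omega)).step hUK hU hn
      exact (inv k le_rfl).done s h.start k le_rfl

theorem Interpreter.checkBoundedUntil_dom (h₁ : ∀ t, I.Reachable s t → (check₁ t).Dom)
    (h₂ : ∀ t, I.Reachable s t → (check₂ t).Dom) (k : ℕ) :
    (I.checkBoundedUntil check₁ check₂ k s).Dom := by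
  -- every program decides the set of the states where it answers `true`
  have hcr := I.createBU_spec (s := s) (check₁ := check₁) (check₂ := check₂)
    (B₁ := fun t => true ∈ check₁ t) (B₂ := fun t => true ∈ check₂ t)
    (fun t _ b hb => ⟨fun h => h ▸ hb, fun h => Part.mem_unique hb h⟩)
    (fun t _ b hb => ⟨fun h => h ▸ hb, fun h => Part.mem_unique hb h⟩) k
  have hd : ∀ t, I.Reachable s t → (createBU check₁ check₂ k t).Dom := fun t ht =>
    computeLabel_dom (h₁ t ht) (h₂ t ht)
  refine dom_bind (hd s Relation.ReflTransGen.refl) fun r hr => ?_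
  have hr := hcr s Relation.ReflTransGen.refl r hr
  subst hr
  cases hl : labelOf (fun t => true ∈ check₁ t) (fun t => true ∈ check₂ t) s
  · trivial
  · trivial
  · have h0 := ExpInv.init (I := I) (ini := buInit k) hl
    rw [hl] at h0
    exact ExpInv.expandBounded_dom hcr hd k h0

end

/-! ### The decided states of an unbounded until -/

/-- `K` is a finite set of states containing the successors of its undecided states `U`; `N` are the
states of `K` that cannot reach a `B₂`-state through `U`, and `Y` those that cannot reach `N`. -/
structure Resolved (I : Interpreter S AP) (B₁ B₂ : S → Prop) (K U N Y : Finset S) : Prop where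
  closed : ∀ t ∈ U, ∀ x ∈ I.next t, x.1 ∈ K
  mem_unknown : ∀ t, t ∈ U ↔ t ∈ K ∧ B₁ t ∧ ¬ B₂ t
  mem_no : ∀ t, t ∈ N ↔ t ∈ K ∧ ¬ ∃ r, (r ∈ K ∧ B₂ r) ∧ Relation.ReflTransGen (I.Edge U) t r
  mem_yes : ∀ t, t ∈ Y ↔ t ∈ K ∧ ¬ ∃ r ∈ N, Relation.ReflTransGen (I.Edge U) t r

section
variable {I : Interpreter S AP} {B₁ B₂ : S → Prop} {K U N Y : Finset S}

theorem Interpreter.eq_of_reach_of_notMem {t r : S} (ht : t ∉ U)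
    (h : Relation.ReflTransGen (I.Edge U) t r) : r = t := by
  rcases Relation.ReflTransGen.cases_head h with rfl | ⟨c, hc, -⟩
  exacts [rfl, absurd hc.1 ht]

namespace Resolved

theorem not_right_of_mem_no (h : Resolved I B₁ B₂ K U N Y) {t : S} (ht : t ∈ N) : ¬ B₂ t :=
  fun h₂ => ((h.mem_no t).1 ht).2 ⟨t, ⟨((h.mem_no t).1 ht).1, h₂⟩, .refl⟩

theorem notMem_no_of_mem_yes (h : Resolved I B₁ B₂ K U N Y) {t : S} (ht : t ∈ Y) : t ∉ N :=
  fun hN => ((h.mem_yes t).1 ht).2 ⟨t, hN, .refl⟩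

/-- Goal states have no outgoing edges, since only undecided states are expanded. -/
theorem mem_yes_of_right (h : Resolved I B₁ B₂ K U N Y) {t : S} (ht : t ∈ K) (h₂ : B₂ t) :
    t ∈ Y := by
  refine (h.mem_yes t).2 ⟨ht, fun ⟨r, hr, htr⟩ => ?_⟩
  have hU : t ∉ U := fun hU => ((h.mem_unknown t).1 hU).2.2 h₂
  rw [I.eq_of_reach_of_notMem hU htr] at hr
  exact h.not_right_of_mem_no hr h₂

theorem mem_no_of_not (h : Resolved I B₁ B₂ K U N Y) {t : S} (ht : t ∈ K) (h₁ : ¬ B₁ t)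
    (h₂ : ¬ B₂ t) : t ∈ N := by
  refine (h.mem_no t).2 ⟨ht, fun ⟨r, hr, htr⟩ => ?_⟩
  have hU : t ∉ U := fun hU => h₁ ((h.mem_unknown t).1 hU).2.1
  rw [I.eq_of_reach_of_notMem hU htr] at hr
  exact h₂ hr.2

theorem mem_unknown_of_notMem (h : Resolved I B₁ B₂ K U N Y) {t : S} (ht : t ∈ K) (hY : t ∉ Y)
    (hN : t ∉ N) : t ∈ U := by
  refine (h.mem_unknown t).2 ⟨ht, ?_⟩
  by_cases h₂ : B₂ t
  · exact absurd (h.mem_yes_of_right ht h₂) hY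
  · exact ⟨by_contra fun h₁ => hN (h.mem_no_of_not ht h₁ h₂), h₂⟩

theorem harmonic (h : Resolved I B₁ B₂ K U N Y) {t : S} (ht : t ∈ U) :
    I.untilPr B₁ B₂ t = I.expect (I.untilPr B₁ B₂) t :=
  I.untilPr_harmonic ((h.mem_unknown t).1 ht).2.1 ((h.mem_unknown t).1 ht).2.2

theorem untilPr_of_mem_no (h : Resolved I B₁ B₂ K U N Y) {t : S} (ht : t ∈ N) :
    I.untilPr B₁ B₂ t = 0 := by
  refine I.untilPr_eq_zero (Z := (· ∈ N)) (fun t ht => h.not_right_of_mem_no ht)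
    (fun t ht h₁ x hx => ?_) ht
  have hU : t ∈ U :=
    (h.mem_unknown t).2 ⟨((h.mem_no t).1 ht).1, h₁, h.not_right_of_mem_no ht⟩
  refine (h.mem_no x.1).2 ⟨h.closed t hU x hx, fun ⟨r, hr, hxr⟩ => ?_⟩
  exact ((h.mem_no t).1 ht).2 ⟨r, hr, hxr.head ⟨hU, x.2, hx⟩⟩

theorem exists_reach_of_notMem_no (h : Resolved I B₁ B₂ K U N Y) {t : S} (ht : t ∈ K)
    (hN : t ∉ N) : ∃ r, (r ∈ K ∧ B₂ r) ∧ Relation.ReflTransGen (I.Edge U) t r := by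
  by_contra hne
  exact hN ((h.mem_no t).2 ⟨ht, hne⟩)

/-- All states of `Y` reach a `B₂`-state and never leave `Y`, so the minimum principle applies. -/
theorem untilPr_of_mem_yes (h : Resolved I B₁ B₂ K U N Y) {t : S} (ht : t ∈ Y) :
    I.untilPr B₁ B₂ t = 1 := by
  refine le_antisymm (I.untilPr_le_one B₁ B₂ t) ?_
  refine I.one_le_of_harmonic (K := Y) (U := U) (fun t ht => ?_) (fun t ht => ?_) t ht
  · obtain ⟨htK, hr⟩ := (h.mem_yes t).1 ht
    by_cases hU : t ∈ U
    · refine Or.inr ⟨fun x hx => ?_, h.harmonic hU⟩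
      exact (h.mem_yes x.1).2 ⟨h.closed t hU x hx, fun ⟨r, hrN, hxr⟩ =>
        hr ⟨r, hrN, hxr.head ⟨hU, x.2, hx⟩⟩⟩
    · by_cases h₂ : B₂ t
      · exact Or.inl (I.untilPr_of_right h₂).ge
      · refine absurd ((h.mem_unknown t).2 ⟨htK, ?_, h₂⟩) hU
        by_contra h₁
        exact h.notMem_no_of_mem_yes ht (h.mem_no_of_not htK h₁ h₂)
  · obtain ⟨r, hr, htr⟩ :=
      h.exists_reach_of_notMem_no ((h.mem_yes t).1 ht).1 (h.notMem_no_of_mem_yes ht)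
    exact ⟨r, (I.untilPr_of_right hr.2).ge, htr⟩

theorem mem_yes_of_untilPr (h : Resolved I B₁ B₂ K U N Y) {t : S} (ht : t ∈ K)
    (h1 : I.untilPr B₁ B₂ t = 1) : t ∈ Y := by
  refine (h.mem_yes t).2 ⟨ht, fun ⟨r, hr, htr⟩ => ?_⟩
  -- the complementary probability is harmonic, and positive on `N`
  have := I.pos_of_reach (f := fun t => 1 - I.untilPr B₁ B₂ t)
    (fun t => sub_nonneg.2 (I.untilPr_le_one B₁ B₂ t)) (fun t ht => ?_) htr
    (by simp [h.untilPr_of_mem_no hr])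
  · simp [h1] at this
  · rw [I.expect_sub (fun _ => 1), I.expect_const, ← h.harmonic ht]

/-- Reaching `Y` through undecided states is a way to satisfy the until formula. -/
theorem untilVal_yes_le (h : Resolved I B₁ B₂ K U N Y) (i : ℕ) {t : S} (ht : t ∈ K) :
    I.untilVal (· ∈ K \ (Y ∪ N)) (· ∈ Y) i t ≤ I.untilPr B₁ B₂ t := by
  by_cases hY : t ∈ Y
  · rw [I.untilVal_of_right hY, h.untilPr_of_mem_yes hY]
  by_cases hN : t ∈ N
  · rw [I.untilVal_of_not (by simp [hN]) hY]
    exact I.untilPr_nonneg _ _ _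
  have hU := h.mem_unknown_of_notMem ht hY hN
  induction i generalizing t with
  | zero => simpa [Interpreter.untilVal, hY] using I.untilPr_nonneg B₁ B₂ t
  | succ i ih =>
    rw [Interpreter.untilVal, if_neg hY, if_pos (by simp [ht, hY, hN]), h.harmonic hU]
    refine I.expect_mono fun x hx => ?_
    have hxK := h.closed t hU x hx
    by_cases hxY : x.1 ∈ Y
    · rw [I.untilVal_of_right hxY, h.untilPr_of_mem_yes hxY]
    by_cases hxN : x.1 ∈ N
    · rw [I.untilVal_of_not (by simp [hxN]) hxY]
      exact I.untilPr_nonneg _ _ _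
    exact ih hxK hxY hxN (h.mem_unknown_of_notMem hxK hxY hxN)

/-- Reaching `N` through undecided states is a way to violate the until formula. -/
theorem untilVal_no_le (h : Resolved I B₁ B₂ K U N Y) (i : ℕ) {t : S} (ht : t ∈ K) :
    I.untilVal (· ∈ K \ (Y ∪ N)) (· ∈ N) i t ≤ 1 - I.untilPr B₁ B₂ t := by
  by_cases hN : t ∈ N
  · rw [I.untilVal_of_right hN, h.untilPr_of_mem_no hN, sub_zero]
  by_cases hY : t ∈ Y
  · rw [I.untilVal_of_not (by simp [hY]) hN]
    exact sub_nonneg.2 (I.untilPr_le_one _ _ _)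
  have hU := h.mem_unknown_of_notMem ht hY hN
  induction i generalizing t with
  | zero => simpa [Interpreter.untilVal, hN] using I.untilPr_le_one B₁ B₂ t
  | succ i ih =>
    rw [Interpreter.untilVal, if_neg hN, if_pos (by simp [ht, hY, hN]), h.harmonic hU]
    rw [← I.expect_const 1 t, ← I.expect_sub (fun _ => 1)]
    refine I.expect_mono fun x hx => ?_
    have hxK := h.closed t hU x hx
    by_cases hxN : x.1 ∈ N
    · rw [I.untilVal_of_right hxN, h.untilPr_of_mem_no hxN, sub_zero]
    by_cases hxY : x.1 ∈ Y
    · rw [I.untilVal_of_not (by simp [hxY]) hxN]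
      exact sub_nonneg.2 (I.untilPr_le_one _ _ _)
    exact ih hxK hxN hxY (h.mem_unknown_of_notMem hxK hxY hxN)

/-- Almost surely, `Y` or `N` is reached. -/
theorem eventually_decided (h : Resolved I B₁ B₂ K U N Y) {ε : ℝ} (hε : 0 < ε) :
    ∀ᶠ i in Filter.atTop, ∀ t ∈ K, 1 - ε ≤
      I.untilVal (· ∈ K \ (Y ∪ N)) (· ∈ Y) i t + I.untilVal (· ∈ K \ (Y ∪ N)) (· ∈ N) i t := by
  have hK : ∀ t ∈ K, 1 ≤ I.untilPr (· ∈ K \ (Y ∪ N)) (· ∈ Y) t +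
      I.untilPr (· ∈ K \ (Y ∪ N)) (· ∈ N) t := by
    have h1 : ∀ t ∈ Y, 1 ≤ I.untilPr (· ∈ K \ (Y ∪ N)) (· ∈ Y) t +
        I.untilPr (· ∈ K \ (Y ∪ N)) (· ∈ N) t := fun t ht => by
      rw [I.untilPr_of_right (B₂ := (· ∈ Y)) ht]
      exact le_add_of_nonneg_right (I.untilPr_nonneg _ _ _)
    have h2 : ∀ t ∈ N, 1 ≤ I.untilPr (· ∈ K \ (Y ∪ N)) (· ∈ Y) t +
        I.untilPr (· ∈ K \ (Y ∪ N)) (· ∈ N) t := fun t ht => by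
      rw [I.untilPr_of_right (B₂ := (· ∈ N)) ht]
      exact le_add_of_nonneg_left (I.untilPr_nonneg _ _ _)
    refine I.one_le_of_harmonic (U := U) (f := fun t => I.untilPr (· ∈ K \ (Y ∪ N)) (· ∈ Y) t +
        I.untilPr (· ∈ K \ (Y ∪ N)) (· ∈ N) t) (fun t ht => ?_) (fun t ht => ?_)
    · by_cases hY : t ∈ Y
      · exact Or.inl (h1 t hY)
      by_cases hN : t ∈ N
      · exact Or.inl (h2 t hN)
      have hV : t ∈ K \ (Y ∪ N) := by simp [ht, hY, hN]
      refine Or.inr ⟨h.closed t (h.mem_unknown_of_notMem ht hY hN), ?_⟩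
      rw [I.expect_add]
      exact congrArg₂ _ (I.untilPr_harmonic (B₁ := (· ∈ K \ (Y ∪ N))) (B₂ := (· ∈ Y)) hV hY)
        (I.untilPr_harmonic (B₁ := (· ∈ K \ (Y ∪ N))) (B₂ := (· ∈ N)) hV hN)
    · by_cases hN : t ∈ N
      · exact ⟨t, h2 t hN, .refl⟩
      · obtain ⟨r, hr, htr⟩ := h.exists_reach_of_notMem_no ht hN
        exact ⟨r, h1 r (h.mem_yes_of_right hr.1 hr.2), htr⟩
  refine (Filter.eventually_all_finset K).2 fun t ht => ?_
  have := (I.tendsto_untilVal (· ∈ K \ (Y ∪ N)) (· ∈ Y) t).add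
    (I.tendsto_untilVal (· ∈ K \ (Y ∪ N)) (· ∈ N) t)
  exact (this.eventually_const_lt (show 1 - ε < _ from
    lt_of_lt_of_le (by linarith) (hK t ht))).mono fun _ => le_of_lt

end Resolved

end

/-! ### The computation phase for unbounded until -/

/-- The array `pYes` or `pNo`, so that both can be treated alike. -/
def UUData.prob (d : UUData) : Bool → Fin 2 → ℝ
  | true => d.pYes
  | false => d.pNo

theorem par_ne (i : ℕ) : par i ≠ par (i + 1) := by
  intro h
  have := congrArg Fin.val h
  simp only [par, Fin.ofNat, Fin.val_mk] at this
  omega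

theorem eq_par_or (i : ℕ) (j : Fin 2) : j = par i ∨ j = par (i + 1) := by
  have h1 : (par i).val = i % 2 := rfl
  have h2 : (par (i + 1)).val = (i + 1) % 2 := rfl
  have := j.isLt
  rcases Nat.mod_two_eq_zero_or_one i with h | h <;>
  · rw [Fin.ext_iff, Fin.ext_iff, h1, h2]
    omega

section
variable (i : ℕ) (p : ℝ) (d : UUData) (r : Record S UUData)

theorem uuAdd_prec : (uuAdd i p d r).prec = r.prec := by
  unfold uuAdd; split <;> rfl

theorem uuAdd_label : (uuAdd i p d r).label = r.label := by
  unfold uuAdd; split <;> simp_all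

theorem uuAdd_prob (b : Bool) : (uuAdd i p d r).data.prob b (par i) = r.data.prob b (par i) := by
  have := par_ne i
  unfold uuAdd
  split
  · cases b <;> simp [UUData.prob, this]
  · rfl

theorem uuAdd_prob_succ (b : Bool) : (uuAdd i p d r).data.prob b (par (i + 1)) =
    r.data.prob b (par (i + 1)) + if r.label = .unknown then p * d.prob b (par i) else 0 := by
  unfold uuAdd
  split
  · cases b <;> simp_all [UUData.prob]
  · rw [if_neg (by assumption), add_zero]

theorem uuAdd_of_decided (h : r.label ≠ .unknown) : uuAdd i p d r = r := by
  unfold uuAdd; split <;> simp_all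

theorem uuReset_prec : (uuReset i r).prec = r.prec := by
  unfold uuReset; split <;> rfl

theorem uuReset_label : (uuReset i r).label = r.label := by
  unfold uuReset; split <;> simp_all

theorem uuReset_prob (b : Bool) : (uuReset i r).data.prob b (par i) = r.data.prob b (par i) := by
  have := par_ne i
  unfold uuReset
  split
  · cases b <;> simp [UUData.prob, this]
  · rfl

theorem uuReset_prob_succ (h : r.label = .unknown) (b : Bool) :
    (uuReset i r).data.prob b (par (i + 1)) = 0 := by
  unfold uuReset
  split
  · cases b <;> simp [UUData.prob]
  · contradiction

theorem uuReset_of_decided (h : r.label ≠ .unknown) : uuReset i r = r := by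
  unfold uuReset; split <;> simp_all

end

/-- The invariant of the computation phase for unbounded until. `T true` are the states labelled
`yes`, `T false` those labelled `no`, and `V` those labelled `unknown`. Outside `A` both entries of
the arrays vanish, so it does no harm that only the records in `A` are reset. -/
structure UUInv (I : Interpreter S AP) (K U V : Finset S) (T : Bool → Finset S) (st : UUState S) :
    Prop where
  keys : st.M.keys = K
  prec : I.PrecOf U st.M
  label : ∀ t ∈ K, (st.M.val t).label = .unknown ↔ t ∈ V
  current : ∀ t ∈ K, ∀ b,
    (st.M.val t).data.prob b (par st.i) = I.untilVal (· ∈ V) (· ∈ T b) st.i t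
  decided : ∀ t ∈ K, t ∉ V → ∀ b j j', (st.M.val t).data.prob b j = (st.M.val t).data.prob b j'
  mem_A : ∀ t ∈ K, t ∉ V → t ∈ st.A
  untouched : ∀ t ∈ V, t ∉ st.A → ∀ b j, (st.M.val t).data.prob b j = 0

theorem UUInv.step {I : Interpreter S AP} {K U V : Finset S} {T : Bool → Finset S} {st : UUState S}
    (hVU : V ⊆ U) (hVK : V ⊆ K) (hUK : ∀ t ∈ U, ∀ x ∈ I.next t, x.1 ∈ K)
    (hVT : ∀ t ∈ V, ∀ b, t ∉ T b) (h : UUInv I K U V T st) : UUInv I K U V T (uuIter st) := by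
  set M₁ := st.M.modifyAll st.A (uuReset st.i) with hM₁
  set M' := st.A.toList.foldl (relax (uuAdd st.i)) M₁ with hM'
  have hit : uuIter st = ⟨M', precClosure M' st.A, st.i + 1⟩ := rfl
  have hval : ∀ t, M₁.val t = if t ∈ st.A then uuReset st.i (st.M.val t) else st.M.val t :=
    fun _ => rfl
  have hprec₁ : I.PrecOf U M₁ := by
    intro t
    rw [← h.prec t, hval]
    split_ifs
    · rw [uuReset_prec]
    · rfl
  have hprec : I.PrecOf U M' := hprec₁.foldl_relax (uuAdd_prec st.i) _
  have hkeys : M'.keys = K := by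
    rw [hM', foldl_relax_keys]
    exact h.keys
  have hlabel : ∀ t, (M'.val t).label = (st.M.val t).label := by
    intro t
    rw [hM', foldl_relax_invariant (fun r => r.label) (uuAdd_label st.i), hval]
    split_ifs
    · rw [uuReset_label]
    · rfl
  have hlabel₁ : ∀ t, (M₁.val t).label = (st.M.val t).label := by
    intro t
    rw [hval]
    split_ifs
    · rw [uuReset_label]
    · rfl
  have hprob₁ : ∀ t b, (M₁.val t).data.prob b (par st.i) =
      (st.M.val t).data.prob b (par st.i) := by
    intro t b
    rw [hval]
    split_ifs
    · rw [uuReset_prob]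
    · rfl
  have hprob : ∀ t b, (M'.val t).data.prob b (par st.i) =
      (st.M.val t).data.prob b (par st.i) := by
    intro t b
    rw [hM', foldl_relax_invariant (g := uuAdd st.i) (fun r => r.data.prob b (par st.i))
      (fun p d r => uuAdd_prob st.i p d r b), hprob₁]
  have hdec : ∀ t ∈ K, t ∉ V → (M'.val t).data = (st.M.val t).data := by
    intro t ht hV
    have hl : (st.M.val t).label ≠ .unknown := fun hl => hV ((h.label t ht).1 hl)
    -- the data of a decided record is an invariant of `uuAdd`
    have h1 := foldl_relax_invariant (g := uuAdd st.i)
      (fun r : Record S UUData => if r.label = .unknown then none else some r.data)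
      (fun p d r => by
        by_cases hr : r.label = .unknown
        · simp [uuAdd_label, hr]
        · rw [uuAdd_of_decided _ _ _ _ hr]) st.A.toList t M₁
    have h2 : M₁.val t = st.M.val t := by
      rw [hval, uuReset_of_decided _ _ hl, ite_self]
    rw [← hM', h2] at h1
    simpa [hlabel t, hl] using h1
  have hnext : ∀ t ∈ V, ∀ b, (M'.val t).data.prob b (par (st.i + 1)) =
      I.expect (fun r => if r ∈ st.A then (st.M.val r).data.prob b (par st.i) else 0) t := by
    intro t ht b
    have hl : (st.M.val t).label = .unknown := (h.label t (hVK ht)).2 ht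
    have h0 : (M₁.val t).data.prob b (par (st.i + 1)) = 0 := by
      rw [hval]
      split_ifs with hA
      · exact uuReset_prob_succ _ _ hl b
      · exact h.untouched t ht hA b _
    have h1 := hprec₁.relax (g := uuAdd st.i) (fun d => d.prob b (par st.i))
      (fun r => r.data.prob b (par (st.i + 1))) (fun r => r.label = .unknown)
      (fun p d r => uuAdd_prob st.i p d r b) (fun p d r => by rw [uuAdd_label])
      (uuAdd_prec st.i) (fun p d r => uuAdd_prob_succ st.i p d r b) st.A t
    simp only [h0, hlabel₁, hl, hVU ht, and_self, if_true, zero_add, hprob₁] at h1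
    exact h1
  rw [hit]
  refine ⟨hkeys, hprec, fun t ht => by rw [← h.label t ht, ← hlabel], ?_, ?_, ?_, ?_⟩
  · intro t ht b
    by_cases hV : t ∈ V
    · simp only
      rw [hnext t hV, Interpreter.untilVal, if_neg (hVT t hV b), if_pos hV]
      refine I.expect_congr fun x hx => ?_
      have hxK := hUK t (hVU hV) x hx
      rw [← h.current x.1 hxK b]
      split_ifs with hA
      · rfl
      · exact (h.untouched x.1 (by_contra fun hxV => hA (h.mem_A x.1 hxK hxV)) hA b _).symm
    · simp only
      rw [hdec t ht hV, h.decided t ht hV b _ (par st.i), h.current t ht b]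
      by_cases hT : t ∈ T b
      · rw [I.untilVal_of_right (B₂ := (· ∈ T b)) hT, I.untilVal_of_right (B₂ := (· ∈ T b)) hT]
      · rw [I.untilVal_of_not (B₁ := (· ∈ V)) (B₂ := (· ∈ T b)) hV hT,
          I.untilVal_of_not (B₁ := (· ∈ V)) (B₂ := (· ∈ T b)) hV hT]
  · intro t ht hV b j j'
    simp only
    rw [hdec t ht hV]
    exact h.decided t ht hV b j j'
  · intro t ht hV
    rw [hprec.mem_precClosure, hkeys]
    exact ⟨ht, Or.inl (h.mem_A t ht hV)⟩
  · intro t hV hA b j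
    rw [hprec.mem_precClosure, hkeys] at hA
    push Not at hA
    obtain ⟨hA, hE⟩ := hA (hVK hV)
    simp only
    rcases eq_par_or st.i j with rfl | rfl
    · rw [hprob]
      exact h.untouched t hV hA b _
    · rw [hnext t hV, I.expect_congr (g := fun _ => 0), I.expect_const]
      intro x hx
      exact if_neg fun hxA => hE x.1 hxA ⟨hVU hV, x.2, hx⟩

section
variable {I : Interpreter S AP} {B₁ B₂ : S → Prop} {s : S} {U : Finset S}
  {st : ExpState S UUData}

theorem ExpInv.resolved (h : ExpInv I s (labelOf B₁ B₂) uuInit (I.edges U) U st)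
    (hT : st.toExpand = ∅) (M₁ : Table S (Record S UUData)) (hk : M₁.keys = st.M.keys)
    (hM₁ : I.PrecOf U M₁) : Resolved I B₁ B₂ st.M.keys U (cannotReach st.M st.yes)
      (cannotReach M₁ (cannotReach st.M st.yes)) where
  closed t ht x hx := h.target (t, x.1, x.2) (I.mem_edges.2 ⟨ht, hx⟩)
  mem_unknown t := by
    rw [← labelOf_eq_unknown, ← h.unknown]
    simp [hT]
  mem_no t := by
    rw [Interpreter.PrecOf.mem_cannotReach (U := U) (I := I) h.prec]
    simp only [h.yes, labelOf_eq_yes]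
  mem_yes t := by rw [hM₁.mem_cannotReach, hk]

end

section
variable {I : Interpreter S AP} {B₁ B₂ : S → Prop} {s : S} {U : Finset S} {ε : ℝ}
  {st : ExpState S UUData}

/-- The table after relabelling with `no` the states of `N`. -/
def relabelNo (M : Table S (Record S UUData)) (N : Finset S) : Table S (Record S UUData) :=
  M.modifyAll N fun r => { r with label := .no, data := { r.data with pNo := fun _ => 1 } }

/-- The table after relabelling with `yes` the states of `Y`. -/
def relabelYes (M : Table S (Record S UUData)) (Y : Finset S) : Table S (Record S UUData) :=
  M.modifyAll Y fun r => { r with label := .yes, data := { r.data with pYes := fun _ => 1 } }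

theorem uuCompute_eq (ε : ℝ) (s : S) (M : Table S (Record S UUData)) (yes : Finset S) :
    uuCompute ε s M yes =
      if yes = ∅ then Part.some 0
      else if cannotReach M yes = ∅ then Part.some 1
      else (uuLoop ε ⟨relabelYes (relabelNo M (cannotReach M yes))
          (cannotReach (relabelNo M (cannotReach M yes)) (cannotReach M yes)),
        cannotReach (relabelNo M (cannotReach M yes)) (cannotReach M yes) ∪ cannotReach M yes,
        0⟩).map fun st => (st.M.val s).data.pYes (par st.i) := rfl

theorem Interpreter.PrecOf.relabelNo {M : Table S (Record S UUData)} (h : I.PrecOf U M)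
    (N : Finset S) : I.PrecOf U (relabelNo M N) := by
  intro t
  rw [← h t]
  simp only [PCTL.relabelNo, Table.modifyAll]
  split_ifs <;> rfl

theorem Interpreter.PrecOf.relabelYes {M : Table S (Record S UUData)} (h : I.PrecOf U M)
    (Y : Finset S) : I.PrecOf U (relabelYes M Y) := by
  intro t
  rw [← h t]
  simp only [PCTL.relabelYes, Table.modifyAll]
  split_ifs <;> rfl

theorem ExpInv.uuInv (h : ExpInv I s (labelOf B₁ B₂) uuInit (I.edges U) U st) {N Y : Finset S}
    (hR : Resolved I B₁ B₂ st.M.keys U N Y) :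
    UUInv I st.M.keys U (st.M.keys \ (Y ∪ N)) (fun b => if b then Y else N)
      ⟨relabelYes (relabelNo st.M N) Y, Y ∪ N, 0⟩ := by
  have hprec : I.PrecOf U st.M := h.prec
  have hdata : ∀ t ∈ st.M.keys, ∀ b j, ((relabelYes (relabelNo st.M N) Y).val t).data.prob b j =
      if t ∈ (if b then Y else N) then 1 else 0 := by
    intro t ht b j
    have hd := h.data t ht
    by_cases hY : t ∈ Y
    · have hN := hR.notMem_no_of_mem_yes hY
      have hl : labelOf B₁ B₂ t ≠ .no := by
        intro hl
        refine hN (hR.mem_no_of_not ht ?_ ?_)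
        · intro h₁; simp only [labelOf, h₁] at hl; split_ifs at hl
        · intro h₂; simp [labelOf, h₂] at hl
      cases b
      · cases hlab : labelOf B₁ B₂ t <;>
          simp_all [relabelYes, relabelNo, Table.modifyAll, UUData.prob, uuInit]
      · simp [relabelYes, relabelNo, Table.modifyAll, UUData.prob, hY]
    · by_cases hN : t ∈ N
      · have hl : labelOf B₁ B₂ t ≠ .yes := fun hl =>
          hR.not_right_of_mem_no hN (labelOf_eq_yes.1 hl)
        cases b
        · simp [relabelYes, relabelNo, Table.modifyAll, UUData.prob, hY, hN]
        · cases hlab : labelOf B₁ B₂ t <;>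
            simp_all [relabelYes, relabelNo, Table.modifyAll, UUData.prob, uuInit]
      · have hl : labelOf B₁ B₂ t = .unknown :=
          labelOf_eq_unknown.2 ((hR.mem_unknown t).1 (hR.mem_unknown_of_notMem ht hY hN)).2
        cases b <;>
          simp [relabelYes, relabelNo, Table.modifyAll, UUData.prob, hY, hN, hd, hl, uuInit]
  refine ⟨rfl, (hprec.relabelNo N).relabelYes Y, ?_, ?_, ?_, ?_, ?_⟩
  · intro t ht
    by_cases hY : t ∈ Y
    · simp [relabelYes, Table.modifyAll, hY]
    · by_cases hN : t ∈ N
      · simp [relabelYes, relabelNo, Table.modifyAll, hY, hN]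
      · have hl : labelOf B₁ B₂ t = .unknown :=
          labelOf_eq_unknown.2 ((hR.mem_unknown t).1 (hR.mem_unknown_of_notMem ht hY hN)).2
        simp [relabelYes, relabelNo, Table.modifyAll, hY, hN, h.label t ht, hl, ht]
  · exact fun t ht b => (hdata t ht b _).trans (by rw [Interpreter.untilVal]; congr)
  · exact fun t ht _ b j j' => (hdata t ht b j).trans (hdata t ht b j').symm
  · intro t ht hV
    simpa [ht, or_iff_not_imp_left] using hV
  · intro t hV hA b j
    rw [hdata t (Finset.mem_sdiff.1 hV).1]
    have := Finset.notMem_union.1 hA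
    cases b <;> simp [this]

theorem Resolved.uuInv_step {K N Y : Finset S} (hR : Resolved I B₁ B₂ K U N Y) {st : UUState S}
    (h : UUInv I K U (K \ (Y ∪ N)) (fun b => if b then Y else N) st) :
    UUInv I K U (K \ (Y ∪ N)) (fun b => if b then Y else N) (uuIter st) := by
  refine h.step (fun t ht => ?_) Finset.sdiff_subset hR.closed (fun t ht b => ?_)
  · simp only [Finset.mem_sdiff, Finset.mem_union, not_or] at ht
    exact hR.mem_unknown_of_notMem ht.1 ht.2.1 ht.2.2
  · simp only [Finset.mem_sdiff, Finset.mem_union, not_or] at ht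
    cases b <;> simp [ht]

theorem ExpInv.uuCompute_spec (h : ExpInv I s (labelOf B₁ B₂) uuInit (I.edges U) U st)
    (hT : st.toExpand = ∅) (hε : 0 < ε) {q : ℝ} (hq : q ∈ uuCompute ε s st.M st.yes) :
    Approx ε q (I.untilPr B₁ B₂ s) := by
  have hprec : I.PrecOf U st.M := h.prec
  have hR := h.resolved hT (relabelNo st.M (cannotReach st.M st.yes)) rfl (hprec.relabelNo _)
  have hx0 := I.untilPr_nonneg B₁ B₂ s
  have hx1 := I.untilPr_le_one B₁ B₂ s
  rw [uuCompute_eq] at hq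
  split_ifs at hq with hyes hno
  · rw [Part.mem_some_iff.1 hq]
    have : I.untilPr B₁ B₂ s = 0 := hR.untilPr_of_mem_no (by
      rw [hprec.mem_cannotReach]
      simp [hyes, h.start])
    rw [this]
    constructor <;> simp [hε.le]
  · rw [Part.mem_some_iff.1 hq]
    have : I.untilPr B₁ B₂ s = 1 := hR.untilPr_of_mem_yes (by
      rw [(hprec.relabelNo _).mem_cannotReach]
      exact ⟨h.start, by simp [hno]⟩)
    rw [this]
    constructor <;> simp [hε.le]
  · obtain ⟨st', hst', rfl⟩ := (Part.mem_map_iff _).1 hq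
    obtain ⟨h', hc⟩ := whileLoop_invariant _ (fun st h _ st' hst' => by
      rw [Part.mem_some_iff.1 hst']
      exact hR.uuInv_step h) (h.uuInv hR) hst'
    push Not at hc
    have hc := hc s (by rw [h'.keys]; exact h.start)
    have hy := h'.current s h.start true
    have hn := h'.current s h.start false
    simp only [UUData.prob, if_true, Bool.false_eq_true, if_false] at hy hn
    have h1 := hR.untilVal_yes_le st'.i h.start
    have h2 := hR.untilVal_no_le st'.i h.start
    rw [hy, hn] at hc
    rw [hy]
    have h3 := I.untilVal_nonneg (· ∈ st.M.keys \ (cannotReach (relabelNo st.M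
      (cannotReach st.M st.yes)) (cannotReach st.M st.yes) ∪ cannotReach st.M st.yes))
      (· ∈ cannotReach (relabelNo st.M (cannotReach st.M st.yes)) (cannotReach st.M st.yes)) st'.i s
    refine ⟨h3, h1.trans hx1, ?_, fun h0 => le_antisymm (h1.trans h0.le) h3, fun h1 => ?_⟩
    · rw [abs_le]
      constructor <;> linarith
    · exact I.untilVal_of_right (B₂ := (· ∈ cannotReach (relabelNo st.M
        (cannotReach st.M st.yes)) (cannotReach st.M st.yes))) (hR.mem_yes_of_untilPr h.start h1)

theorem ExpInv.uuCompute_dom (h : ExpInv I s (labelOf B₁ B₂) uuInit (I.edges U) U st)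
    (hT : st.toExpand = ∅) (hε : 0 < ε) : (uuCompute ε s st.M st.yes).Dom := by
  have hprec : I.PrecOf U st.M := h.prec
  have hR := h.resolved hT (relabelNo st.M (cannotReach st.M st.yes)) rfl (hprec.relabelNo _)
  obtain ⟨n, hn⟩ := Filter.eventually_atTop.1 (hR.eventually_decided hε)
  rw [uuCompute_eq]
  split_ifs
  · trivial
  · trivial
  · refine whileLoop_dom _ (fun st => n - st.i) (fun st' h' hc => ⟨trivial, fun st'' hst'' => ?_⟩)
      (h.uuInv hR)
    rw [Part.mem_some_iff.1 hst'']
    refine ⟨hR.uuInv_step h', ?_⟩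
    have : st'.i < n := by
      by_contra! hle
      obtain ⟨r, hr, hlt⟩ := hc
      rw [h'.keys] at hr
      have hy := h'.current r hr true
      have hno := h'.current r hr false
      simp only [UUData.prob, if_true, Bool.false_eq_true, if_false] at hy hno
      rw [hy, hno] at hlt
      exact absurd (hn st'.i hle r hr) (not_le.2 hlt)
    change n - (st'.i + 1) < n - st'.i
    omega

variable {check₁ check₂ : S → Part Bool}

theorem Interpreter.createUU_spec (h₁ : ∀ t, I.Reachable s t → Decides check₁ B₁ t)
    (h₂ : ∀ t, I.Reachable s t → Decides check₂ B₂ t) (t : S) (ht : I.Reachable s t)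
    (r : Record S UUData) (hr : r ∈ createUU check₁ check₂ t) :
    r = ⟨[], labelOf B₁ B₂ t, uuInit (labelOf B₁ B₂ t)⟩ := by
  rw [createUU_eq] at hr
  obtain ⟨l, hl, rfl⟩ := (Part.mem_map_iff _).1 hr
  rw [computeLabel_spec (h₁ t ht) (h₂ t ht) hl]

theorem Interpreter.checkUnboundedUntil_spec (hε : 0 < ε)
    (h₁ : ∀ t, I.Reachable s t → Decides check₁ B₁ t)
    (h₂ : ∀ t, I.Reachable s t → Decides check₂ B₂ t) {q : ℝ}
    (hq : q ∈ I.checkUnboundedUntil ε check₁ check₂ s) :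
    Approx ε q (I.pr s (UntilAlong B₁ B₂)) := by
  change Approx ε q (I.untilPr B₁ B₂ s)
  have hcr := I.createUU_spec h₁ h₂
  obtain ⟨r, hr, hq⟩ := Part.mem_bind_iff.1 hq
  have hr := hcr s Relation.ReflTransGen.refl r hr
  subst hr
  cases hl : labelOf B₁ B₂ s
  · rw [hl] at hq
    rw [Part.mem_some_iff.1 hq, I.untilPr_of_right (labelOf_eq_yes.1 hl)]
    constructor <;> simp [hε.le]
  · rw [hl] at hq
    rw [Part.mem_some_iff.1 hq, I.untilPr_of_not]
    · constructor <;> simp [hε.le]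
    · exact fun h => by simp only [labelOf, h] at hl; split_ifs at hl
    · exact fun h => by simp [labelOf, h] at hl
  · have h0 := ExpInv.init (I := I) (ini := uuInit) hl
    have hq : q ∈ (I.expandUnbounded (createUU check₁ check₂) (ExpState.init s
        ⟨[], labelOf B₁ B₂ s, uuInit (labelOf B₁ B₂ s)⟩)).bind fun st =>
        uuCompute ε s st.M st.yes := by
      simpa only [hl] using hq
    obtain ⟨st, hst, hq⟩ := Part.mem_bind_iff.1 hq
    obtain ⟨U, h, hT⟩ := ExpInv.expandUnbounded hcr h0 hst
    exact h.uuCompute_spec hT hε hq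

theorem Interpreter.checkUnboundedUntil_dom (hε : 0 < ε) (hfin : {t | I.Reachable s t}.Finite)
    (h₁ : ∀ t, I.Reachable s t → (check₁ t).Dom)
    (h₂ : ∀ t, I.Reachable s t → (check₂ t).Dom) :
    (I.checkUnboundedUntil ε check₁ check₂ s).Dom := by
  -- every program decides the set of the states where it answers `true`
  have hcr := I.createUU_spec (s := s) (check₁ := check₁) (check₂ := check₂)
    (B₁ := fun t => true ∈ check₁ t) (B₂ := fun t => true ∈ check₂ t)
    (fun t _ b hb => ⟨fun h => h ▸ hb, fun h => Part.mem_unique hb h⟩)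
    (fun t _ b hb => ⟨fun h => h ▸ hb, fun h => Part.mem_unique hb h⟩)
  have hd : ∀ t, I.Reachable s t → (createUU check₁ check₂ t).Dom := fun t ht =>
    computeLabel_dom (h₁ t ht) (h₂ t ht)
  refine dom_bind (hd s Relation.ReflTransGen.refl) fun r hr => ?_
  have hr := hcr s Relation.ReflTransGen.refl r hr
  subst hr
  cases hl : labelOf (fun t => true ∈ check₁ t) (fun t => true ∈ check₂ t) s
  · trivial
  · trivial
  · have h0 := ExpInv.init (I := I) (ini := uuInit) hl
    rw [hl] at h0
    refine dom_bind (h0.expandUnbounded_dom hcr hd hfin) fun st hst => ?_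
    obtain ⟨U, h, hT⟩ := h0.expandUnbounded hcr hst
    exact h.uuCompute_dom hT hε

end

/-! ### The recursion on formulas -/

/-- Induction on state formulas, with the path formulas inlined. -/
theorem StateFormula.induction {P : StateFormula AP → Prop} (atom : ∀ a, P (.atom a))
    (neg : ∀ Φ, P Φ → P (.neg Φ)) (or : ∀ Φ₁ Φ₂, P Φ₁ → P Φ₂ → P (.or Φ₁ Φ₂))
    (next : ∀ c p Φ, P Φ → P (.prob c p (.next Φ)))
    (boundedUntil : ∀ c p Φ₁ k Φ₂, P Φ₁ → P Φ₂ → P (.prob c p (.boundedUntil Φ₁ k Φ₂)))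
    (unboundedUntil : ∀ c p Φ₁ Φ₂, P Φ₁ → P Φ₂ → P (.prob c p (.unboundedUntil Φ₁ Φ₂)))
    (Φ : StateFormula AP) : P Φ :=
  StateFormula.rec (motive_1 := P) (motive_2 := fun φ => ∀ c p, P (.prob c p φ))
    atom neg or (fun c p _ h => h c p) (fun Φ h c p => next c p Φ h)
    (fun Φ₁ k Φ₂ h₁ h₂ c p => boundedUntil c p Φ₁ k Φ₂ h₁ h₂)
    (fun Φ₁ Φ₂ h₁ h₂ c p => unboundedUntil c p Φ₁ Φ₂ h₁ h₂) Φ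

theorem Interpreter.foldlM_next_spec {check : S → Part Bool} {B : S → Prop} {l : List (S × ℝ)}
    (h : ∀ x ∈ l, Decides check B x.1) {b q : ℝ}
    (hq : q ∈ l.foldlM (fun (p : ℝ) x => (check x.1).map fun b => if b then p + x.2 else p) b) :
    q = b + (l.map fun x => x.2 * if B x.1 then 1 else 0).sum := by
  induction l generalizing b with
  | nil =>
    rw [mem_foldlM_nil] at hq
    simp [hq]
  | cons x l ih =>
    obtain ⟨b', hb', hq⟩ := mem_foldlM_cons.1 hq
    obtain ⟨c, hc, rfl⟩ := (Part.mem_map_iff _).1 hb'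
    have := h x (by simp) c hc
    rw [ih (fun y hy => h y (by simp [hy])) hq, List.map_cons, List.sum_cons, ← add_assoc]
    cases c <;> simp_all

theorem Interpreter.reachable_of_mem_next (I : Interpreter S AP) {s : S} {x : S × ℝ}
    (hx : x ∈ I.next s) : I.Reachable s x.1 :=
  Relation.ReflTransGen.single (I.trans_pos_iff.2 ⟨x.2, hx⟩)

theorem Interpreter.decides_prob {I : Interpreter S AP} {ε : ℝ} {c : Cmp} {p : unitInterval}
    {φ : PathFormula AP} {s : S} {B : S → Prop}
    (h : ∀ q ∈ I.checkPath ε φ s, (B s ↔ c.holds q p)) :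
    Decides (I.check ε (.prob c p φ)) B s := by
  intro b hb
  rw [Interpreter.check] at hb
  obtain ⟨q, hq, rfl⟩ := (Part.mem_map_iff _).1 hb
  rw [decide_eq_true_iff, h q hq]

/-- `check` decides every relation `R` that obeys the clauses of the satisfaction relation and agrees
with the algorithm on unbounded until, in the states where a condition `C` holds that is inherited
by reachable states and by formulas with fewer unbounded untils. -/
theorem Interpreter.decides_of_clauses {I : Interpreter S AP} {ε : ℝ} (hε : 0 < ε)
    {R C : StateFormula AP → S → Prop}
    (hreach : ∀ Φ s t, C Φ s → I.Reachable s t → C Φ t)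
    (hsub : ∀ Φ Ψ s, Ψ.untils ⊆ Φ.untils → C Φ s → C Ψ s)
    (atom : ∀ a s, R (.atom a) s ↔ I.labEval s a = true)
    (neg : ∀ Φ s, R (.neg Φ) s ↔ ¬ R Φ s)
    (or : ∀ Φ₁ Φ₂ s, R (.or Φ₁ Φ₂) s ↔ R Φ₁ s ∨ R Φ₂ s)
    (next : ∀ c p Φ s, R (.prob c p (.next Φ)) s ↔ c.holds (I.pr s fun σ => R Φ (σ 1)) p)
    (boundedUntil : ∀ c p Φ₁ k Φ₂ s, R (.prob c p (.boundedUntil Φ₁ k Φ₂)) s ↔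
      c.holds (I.pr s (BoundedUntilAlong (R Φ₁) k (R Φ₂))) p)
    (unboundedUntil : ∀ c p Φ₁ Φ₂ s, C (.prob c p (.unboundedUntil Φ₁ Φ₂)) s →
      ∀ q ∈ I.checkPath ε (.unboundedUntil Φ₁ Φ₂) s,
        Approx ε q (I.pr s (UntilAlong (R Φ₁) (R Φ₂))) →
        (R (.prob c p (.unboundedUntil Φ₁ Φ₂)) s ↔ c.holds q p))
    (Φ : StateFormula AP) : ∀ s, C Φ s → Decides (I.check ε Φ) (R Φ) s := by
  induction Φ using StateFormula.induction with
  | atom a =>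
    intro s _ b hb
    rw [check, Part.mem_some_iff] at hb
    rw [hb, atom]
  | neg Φ ih =>
    intro s hC b hb
    rw [check] at hb
    obtain ⟨b', hb', rfl⟩ := (Part.mem_map_iff _).1 hb
    have := ih s (hsub _ _ s (by rw [StateFormula.untils]) hC) b' hb'
    rw [neg, ← this]
    simp
  | or Φ₁ Φ₂ ih₁ ih₂ =>
    intro s hC b hb
    rw [check] at hb
    obtain ⟨b', hb', hb⟩ := Part.mem_bind_iff.1 hb
    have h₁ := ih₁ s (hsub _ _ s (by rw [StateFormula.untils.eq_3]; exact Set.subset_union_left) hC)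
      b' hb'
    rw [or]
    cases b'
    · simp only [Bool.false_eq_true, if_false] at hb
      have h₂ := ih₂ s
        (hsub _ _ s (by rw [StateFormula.untils.eq_3]; exact Set.subset_union_right) hC) b hb
      rw [h₂, ← h₁]
      simp
    · rw [if_pos rfl, Part.mem_some_iff] at hb
      simp [hb, ← h₁]
  | next c p Φ ih =>
    intro s hC
    refine decides_prob fun q hq => ?_
    rw [checkPath] at hq
    have := foldlM_next_spec (fun x hx => ih x.1 (hreach _ s _ (hsub _ _ s
      (by rw [StateFormula.untils.eq_4, PathFormula.untils]) hC) (I.reachable_of_mem_next hx))) hq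
    rw [zero_add] at this
    rw [next, I.pr_next, expect, this]
  | boundedUntil c p Φ₁ k Φ₂ ih₁ ih₂ =>
    intro s hC
    refine decides_prob fun q hq => ?_
    rw [checkPath] at hq
    have := checkBoundedUntil_spec
      (fun t ht => ih₁ t (hreach _ s t (hsub _ _ s (by
        rw [StateFormula.untils.eq_4, PathFormula.untils]; exact Set.subset_union_left) hC) ht))
      (fun t ht => ih₂ t (hreach _ s t (hsub _ _ s (by
        rw [StateFormula.untils.eq_4, PathFormula.untils]; exact Set.subset_union_right) hC) ht)) hq
    rw [boundedUntil, this]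
  | unboundedUntil c p Φ₁ Φ₂ ih₁ ih₂ =>
    intro s hC
    refine decides_prob fun q hq => unboundedUntil c p Φ₁ Φ₂ s hC q hq ?_
    rw [checkPath] at hq
    exact checkUnboundedUntil_spec hε
      (fun t ht => ih₁ t (hreach _ s t (hsub _ _ s (by
        rw [StateFormula.untils.eq_4, PathFormula.untils]
        exact Set.subset_union_left.trans (Set.subset_insert _ _)) hC) ht))
      (fun t ht => ih₂ t (hreach _ s t (hsub _ _ s (by
        rw [StateFormula.untils.eq_4, PathFormula.untils]
        exact Set.subset_union_right.trans (Set.subset_insert _ _)) hC) ht)) hq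

theorem Interpreter.check_dom (I : Interpreter S AP) {ε : ℝ} (hε : 0 < ε) (Φ : StateFormula AP) :
    ∀ s, Φ.untils = ∅ ∨ {t | I.Reachable s t}.Finite → (I.check ε Φ s).Dom := by
  have hreach : ∀ {Φ Ψ : StateFormula AP} {s t}, Ψ.untils ⊆ Φ.untils → I.Reachable s t →
      Φ.untils = ∅ ∨ {t | I.Reachable s t}.Finite →
      Ψ.untils = ∅ ∨ {u | I.Reachable t u}.Finite := by
    intro Φ Ψ s t hsub hst h
    refine h.imp (fun h => ?_) fun h => h.subset fun u hu => hst.trans hu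
    exact Set.subset_eq_empty hsub h
  induction Φ using StateFormula.induction with
  | atom a => exact fun _ _ => trivial
  | neg Φ ih =>
    intro s h
    rw [check]
    exact ih s (hreach (by rw [StateFormula.untils]) .refl h)
  | or Φ₁ Φ₂ ih₁ ih₂ =>
    intro s h
    rw [check]
    refine dom_bind (ih₁ s (hreach (by
      rw [StateFormula.untils.eq_3]; exact Set.subset_union_left) .refl h)) fun b _ => ?_
    split_ifs
    · trivial
    · exact ih₂ s (hreach (by
        rw [StateFormula.untils.eq_3]; exact Set.subset_union_right) .refl h)
  | next c p Φ ih =>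
    intro s h
    rw [check, checkPath]
    exact foldlM_dom
      (f := fun (p : ℝ) (x : S × ℝ) => (I.check ε Φ x.1).map fun b => if b then p + x.2 else p)
      (fun _ _ => True) (fun _ _ _ _ _ _ _ => trivial)
      (fun _ _ x hx _ => by
        change (I.check ε Φ x.1).Dom
        exact ih x.1 (hreach (by rw [StateFormula.untils.eq_4, PathFormula.untils])
          (I.reachable_of_mem_next hx) h)) [] trivial
  | boundedUntil c p Φ₁ k Φ₂ ih₁ ih₂ =>
    intro s h
    rw [check, checkPath]
    exact I.checkBoundedUntil_dom
      (fun t ht => ih₁ t (hreach (by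
        rw [StateFormula.untils.eq_4, PathFormula.untils]; exact Set.subset_union_left) ht h))
      (fun t ht => ih₂ t (hreach (by
        rw [StateFormula.untils.eq_4, PathFormula.untils]; exact Set.subset_union_right) ht h)) k
  | unboundedUntil c p Φ₁ Φ₂ ih₁ ih₂ =>
    intro s h
    have hfin : {t | I.Reachable s t}.Finite := by
      refine h.resolve_left fun h => ?_
      rw [StateFormula.untils, PathFormula.untils] at h
      exact (Set.insert_nonempty _ _).ne_empty h
    rw [check, checkPath]
    exact I.checkUnboundedUntil_dom hε hfin
      (fun t ht => ih₁ t (Or.inr (hfin.subset fun u hu => ht.trans hu)))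
      (fun t ht => ih₂ t (Or.inr (hfin.subset fun u hu => ht.trans hu)))

theorem Approx.holds_iff {ε q x : ℝ} {p : unitInterval} (h : Approx ε q x)
    (hx : x = 0 ∨ x = 1 ∨ ε < |x - p|) (c : Cmp) : c.holds x p ↔ c.holds q p := by
  rcases hx with hx | hx | hx
  · rw [h.eq_zero hx, hx]
  · rw [h.eq_one hx, hx]
  · have h1 := _root_.abs_le.1 h.abs_le
    rcases lt_abs.1 hx with hx | hx <;> cases c <;> simp only [Cmp.holds] <;> constructor <;>
      intro <;> linarith

theorem Approx.refl {ε x : ℝ} (hε : 0 ≤ ε) (h0 : 0 ≤ x) (h1 : x ≤ 1) : Approx ε x x :=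
  ⟨h0, h1, by simpa using hε, id, id⟩

theorem Interpreter.check_correct (I : Interpreter S AP) {ε : ℝ} (hε : 0 < ε)
    (Φ : StateFormula AP) (s : S) (h : I.ThresholdsClear ε Φ s) :
    Decides (I.check ε Φ) (I.Sat Φ) s := by
  refine decides_of_clauses (R := I.Sat) (C := I.ThresholdsClear ε) hε
    (fun Φ s t h hst o ho u hu => h o ho u (hst.trans hu))
    (fun Φ Ψ s hsub h o ho => h o (hsub ho)) (fun a s => ?_) (fun Φ s => ?_) (fun Φ₁ Φ₂ s => ?_)
    (fun c p Φ s => ?_) (fun c p Φ₁ k Φ₂ s => ?_) (fun c p Φ₁ Φ₂ s h q hq ha => ?_) Φ s h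
  · rw [Sat]
  · rw [Sat]
  · rw [Sat]
  · rw [Sat]; rfl
  · rw [Sat]; rfl
  · have := h ⟨p, Φ₁, Φ₂⟩ (by
      rw [StateFormula.untils, PathFormula.untils]; exact Set.mem_insert _ _) s .refl
    have h1 : I.pr s (I.PathSat (.unboundedUntil Φ₁ Φ₂)) =
      I.pr s (UntilAlong (I.Sat Φ₁) (I.Sat Φ₂)) := rfl
    rw [h1] at this
    rw [Sat, h1]
    exact ha.holds_iff this c

mutual
/-- The satisfaction relation in which the probability of an unbounded until is the number computed
by the algorithm, wherever the algorithm terminates. -/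
def Interpreter.ApproxSat (I : Interpreter S AP) (ε : ℝ) : StateFormula AP → S → Prop
  | .atom a, s => I.labEval s a = true
  | .neg Φ, s => ¬ I.ApproxSat ε Φ s
  | .or Φ₁ Φ₂, s => I.ApproxSat ε Φ₁ s ∨ I.ApproxSat ε Φ₂ s
  | .prob c p φ, s => c.holds (I.approxPr ε φ s) p
/-- The probabilities used by `ApproxSat`. -/
def Interpreter.approxPr (I : Interpreter S AP) (ε : ℝ) : PathFormula AP → S → ℝ
  | .next Φ, s => I.pr s fun σ => I.ApproxSat ε Φ (σ 1)
  | .boundedUntil Φ₁ k Φ₂, s => I.pr s (BoundedUntilAlong (I.ApproxSat ε Φ₁) k (I.ApproxSat ε Φ₂))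
  | .unboundedUntil Φ₁ Φ₂, s =>
    if h : (I.checkPath ε (.unboundedUntil Φ₁ Φ₂) s).Dom then
      (I.checkPath ε (.unboundedUntil Φ₁ Φ₂) s).get h
    else I.pr s (UntilAlong (I.ApproxSat ε Φ₁) (I.ApproxSat ε Φ₂))
end

theorem Interpreter.check_approxSat (I : Interpreter S AP) {ε : ℝ} (hε : 0 < ε)
    (Φ : StateFormula AP) (s : S) : Decides (I.check ε Φ) (I.ApproxSat ε Φ) s := by
  refine decides_of_clauses (R := I.ApproxSat ε) (C := fun _ _ => True) hε
    (fun _ _ _ _ _ => trivial) (fun _ _ _ _ _ => trivial) (fun a s => ?_) (fun Φ s => ?_)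
    (fun Φ₁ Φ₂ s => ?_) (fun c p Φ s => ?_) (fun c p Φ₁ k Φ₂ s => ?_)
    (fun c p Φ₁ Φ₂ s _ q hq _ => ?_) Φ s trivial
  · rw [ApproxSat]
  · rw [ApproxSat]
  · rw [ApproxSat]
  · rw [ApproxSat, approxPr]
  · rw [ApproxSat, approxPr]
  · rw [ApproxSat, approxPr, dif_pos (Part.dom_iff_mem.2 ⟨q, hq⟩), Part.get_eq_of_mem hq]

theorem Interpreter.isApproxSat (I : Interpreter S AP) {ε : ℝ} (hε : 0 < ε) :
    I.IsApproxSat ε (I.ApproxSat ε) where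
  atom a s := by rw [ApproxSat]
  neg Φ s := by rw [ApproxSat]
  or Φ₁ Φ₂ s := by rw [ApproxSat]
  next c p Φ s := by rw [ApproxSat, approxPr]
  boundedUntil c p Φ₁ k Φ₂ s := by rw [ApproxSat, approxPr]
  unboundedUntil Φ₁ Φ₂ s := by
    refine ⟨I.approxPr ε (.unboundedUntil Φ₁ Φ₂) s, ?_, fun c p => by rw [ApproxSat]⟩
    rw [approxPr]
    split_ifs with h
    · have hq := Part.get_mem h
      generalize (I.checkPath ε (.unboundedUntil Φ₁ Φ₂) s).get h = q at hq
      rw [checkPath] at hq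
      exact checkUnboundedUntil_spec hε (fun t _ => I.check_approxSat hε Φ₁ t)
        (fun t _ => I.check_approxSat hε Φ₂ t) hq
    · exact Approx.refl hε.le (I.untilPr_nonneg _ _ _) (I.untilPr_le_one _ _ _)

theorem Decides.iff_true_mem {check : S → Part Bool} {B : S → Prop} {s : S}
    (h : Decides check B s) (hd : (check s).Dom) : B s ↔ true ∈ check s := by
  obtain ⟨b, hb⟩ := Part.dom_iff_mem.1 hd
  rw [← h b hb]
  constructor
  · rintro rfl; exact hb
  · exact fun ht => Part.mem_unique hb ht

end PCTL

end

theorem theorem1 {S : Type*} {AP : Type*} (I : PCTL.Interpreter S AP) (ε : ℝ) (hε : 0 < ε) :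
    -- termination
    (∀ (s : S) (Φ : PCTL.StateFormula AP),
      (Φ.untils = ∅ ∨ {t : S | I.Reachable s t}.Finite) → (I.check ε Φ s).Dom) ∧
    -- exact correctness
    (∀ (s : S) (Φ : PCTL.StateFormula AP), (I.check ε Φ s).Dom → I.ThresholdsClear ε Φ s →
      (I.Sat Φ s ↔ true ∈ I.check ε Φ s)) ∧
    -- correctness for all formulas, up to the tolerance
    (∃ R : PCTL.StateFormula AP → S → Prop, I.IsApproxSat ε R ∧
      ∀ (s : S) (Φ : PCTL.StateFormula AP), (I.check ε Φ s).Dom →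
        (R Φ s ↔ true ∈ I.check ε Φ s)) :=
  ⟨fun s Φ h => I.check_dom hε Φ s h,
    fun s Φ hd h => (I.check_correct hε Φ s h).iff_true_mem hd,
    I.ApproxSat ε, I.isApproxSat hε, fun s Φ hd => (I.check_approxSat hε Φ s).iff_true_mem hd⟩
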